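/- Let $f\in\mathbb R[x_1,\dots,x_n]$. Call $\alpha\in\mathbb N^n$ even if $\alpha\in(2\mathbb N)^n$. A trellis is a finite nonempty affinely independent set of even points. A pair $(T,\beta)$ is a circuit if $T$ is a trellis and $\beta\in\mathbb N^n$ lies in the relative interior of $\operatorname{conv}(T)$. A circuit polynomial is a polynomial $\sum_{\alpha\in T}c_\alpha x^\alpha-d\,x^\beta$ with $(T,\beta)$ a circuit, all $c_\alpha>0$ and $d\in\mathbb R$. The polynomial $f$ is SONC if it is a finite sum of circuit polynomials that are nonnegative on $\mathbb R^n$ and of monomial squares $c\,x^\alpha$ ($c\ge 0$, $\alpha$ even). Let $c_\alpha$ be the coefficient of $x^\alpha$ in $f$, and put $\Lambda(f)=\{\alpha\in\operatorname{supp}(f):\alpha \text{ even},\ c_\alpha>0\}$ and $\Gamma(f)=\operatorname{supp}(f)\setminus\Lambda(f)$. For $\beta\in\Gamma(f)$ let $\mathscr C(\beta)$ be the set of all $T\subseteq\Lambda(f)$ such that $(T,\beta)$ is a circuit. Let $\tilde A$ be the set of those $\alpha\in\Lambda(f)$ that lie in no $T\in\mathscr C(\beta)$, $\beta\in\Gamma(f)$.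 Then for every $\beta\in\Gamma(f)$ and $T\in\mathscr C(\beta)$ there is a finite set $M_{T\beta}\subset\mathbb Q^n$ such that $T\cup\{\beta\}\subseteq M_{T\beta}$, every point of $M_{T\beta}\setminus T$ is the average of two distinct points of $M_{T\beta}$, all coordinates of points of $M_{T\beta}$ have odd denominators, and all coordinates of points of $M_{T\beta}\setminus\{\beta\}$ have even numerators (in lowest terms). Moreover, for any choice of such sets $M_{T\beta}$, and any choice, for each $u\in M_{T\beta}\setminus T$, of points $v\neq w$ in $M_{T\beta}$ with $u=\tfrac12(v+w)$, written $v=v_{T\beta u}$ and $w=w_{T\beta u}$, the following are equivalent: (i) $f$ is SONC; (ii) there are real numbers $a_{T\beta u j}$, $b_{T\beta u j}$ such that, as polynomials with rational exponents, $$f=\sum_{\beta\in\Gamma(f)}\ \sum_{T\in\mathscr C(\beta)}\ \sum_{u\in M_{T\beta}\setminus T}\ \sum_{j=1}^{2}\Bigl(a_{T\beta uj}\,x^{\frac12 v_{T\beta u}}-b_{T\beta uj}\,x^{\frac12 w_{T\beta u}}\Bigr)^2+\sum_{\alpha\in\tilde A}c_\alpha x^\alpha .$$ -/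

import Mathlib

namespace SONC

/-- The lattice point `α ∈ ℕⁿ`, seen in `ℝⁿ`. -/
def realPt {n : ℕ} (α : Fin n →₀ ℕ) : Fin n → ℝ := fun i => (α i : ℝ)

/-- The lattice point `α ∈ ℕⁿ`, seen in `ℚⁿ`. -/
def ratPt {n : ℕ} (α : Fin n →₀ ℕ) : Fin n → ℚ := fun i => (α i : ℚ)

/-- `α ∈ (2ℕ)ⁿ`. -/
def IsEvenPt {n : ℕ} (α : Fin n →₀ ℕ) : Prop := ∀ i, Even (α i)

/-- A trellis: a set of even lattice points that comprises the vertices of a (nonempty) simplex. -/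
structure IsTrellis {n : ℕ} (T : Finset (Fin n →₀ ℕ)) : Prop where
  nonempty : T.Nonempty
  even : ∀ α ∈ T, IsEvenPt α
  affineIndependent : AffineIndependent ℝ (fun α : T => realPt (α : Fin n →₀ ℕ))

/-- `(T, β)` is a circuit: `T` is a trellis and `β` is a lattice point in the (relative) interior of
the simplex `conv T`, that is, a convex combination of the vertices with all weights positive. -/
structure IsCircuit {n : ℕ} (T : Finset (Fin n →₀ ℕ)) (β : Fin n →₀ ℕ) : Prop where
  trellis : IsTrellis T
  mem_interior : ∃ wt : (Fin n →₀ ℕ) → ℝ, (∀ α ∈ T, 0 < wt α) ∧ ∑ α ∈ T, wt α = 1 ∧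
    realPt β = ∑ α ∈ T, wt α • realPt α

/-- Circuit polynomials `∑_{α ∈ T} c_α x^α - d x^β`, with all `c_α > 0`. -/
def IsCircuitPolynomial {n : ℕ} (g : MvPolynomial (Fin n) ℝ) : Prop :=
  ∃ (T : Finset (Fin n →₀ ℕ)) (β : Fin n →₀ ℕ) (c : (Fin n →₀ ℕ) → ℝ) (d : ℝ),
    IsCircuit T β ∧ (∀ α ∈ T, 0 < c α) ∧
      g = ∑ α ∈ T, MvPolynomial.monomial α (c α) - MvPolynomial.monomial β d

/-- Monomial squares `c x^α`, with `c ≥ 0` and `α` even. -/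
def IsMonomialSquare {n : ℕ} (g : MvPolynomial (Fin n) ℝ) : Prop :=
  ∃ (α : Fin n →₀ ℕ) (c : ℝ), IsEvenPt α ∧ 0 ≤ c ∧ g = MvPolynomial.monomial α c

/-- Nonnegative circuits: the circuit polynomials that are nonnegative on `ℝⁿ`, and the monomial
squares. -/
def IsNonnegCircuit {n : ℕ} (g : MvPolynomial (Fin n) ℝ) : Prop :=
  (IsCircuitPolynomial g ∧ ∀ x : Fin n → ℝ, 0 ≤ MvPolynomial.eval x g) ∨ IsMonomialSquare g

/-- Sums of (finitely many) nonnegative circuits. -/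
def IsSONC {n : ℕ} (f : MvPolynomial (Fin n) ℝ) : Prop :=
  ∃ (m : ℕ) (g : Fin m → MvPolynomial (Fin n) ℝ), (∀ k, IsNonnegCircuit (g k)) ∧ f = ∑ k, g k

open Classical in
/-- `Λ(f)`: the even exponents of `f` with positive coefficient. -/
noncomputable def posPart {n : ℕ} (f : MvPolynomial (Fin n) ℝ) : Finset (Fin n →₀ ℕ) :=
  f.support.filter (fun α => IsEvenPt α ∧ 0 < f.coeff α)

/-- `Γ(f) = supp(f) \ Λ(f)`. -/
noncomputable def negPart {n : ℕ} (f : MvPolynomial (Fin n) ℝ) : Finset (Fin n →₀ ℕ) :=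
  f.support \ posPart f

open Classical in
/-- `𝒞(β)`: the sets `T ⊆ Λ(f)` for which `(T, β)` is a circuit. -/
noncomputable def circuits {n : ℕ} (f : MvPolynomial (Fin n) ℝ) (β : Fin n →₀ ℕ) :
    Finset (Finset (Fin n →₀ ℕ)) :=
  (posPart f).powerset.filter (fun T => IsCircuit T β)

open Classical in
/-- `Ã`: the points of `Λ(f)` that lie in no `T ∈ 𝒞(β)`, `β ∈ Γ(f)`. -/
noncomputable def leftover {n : ℕ} (f : MvPolynomial (Fin n) ℝ) : Finset (Fin n →₀ ℕ) :=
  (posPart f).filter (fun α => ∀ β ∈ negPart f, ∀ T ∈ circuits f β, α ∉ T)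

/-- The averages of two distinct points of `M ⊆ ℚⁿ`. -/
def ratMidpoints {n : ℕ} (M : Set (Fin n → ℚ)) : Set (Fin n → ℚ) :=
  {u | ∃ v ∈ M, ∃ w ∈ M, v ≠ w ∧ u = (1 / 2 : ℚ) • (v + w)}

/-- `M` is a `T`-rational mediated set. -/
def IsRationalMediated {n : ℕ} (T M : Set (Fin n → ℚ)) : Prop :=
  T ⊆ M ∧ M ⊆ ratMidpoints M ∪ T

/-- `M` is a finite `T`-rational mediated set containing `β`, all of whose points have coordinates
with odd denominators, and all of whose points other than `β` have coordinates with even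
numerators (in lowest terms). -/
structure IsOddMediatedSet {n : ℕ} (T : Finset (Fin n →₀ ℕ)) (β : Fin n →₀ ℕ)
    (M : Finset (Fin n → ℚ)) : Prop where
  mediated : IsRationalMediated (ratPt '' (T : Set (Fin n →₀ ℕ))) (M : Set (Fin n → ℚ))
  mem : ratPt β ∈ M
  odd_den : ∀ u ∈ M, ∀ i, Odd (u i).den
  even_num : ∀ u ∈ M, u ≠ ratPt β → ∀ i, Even (u i).num

/-- Real polynomials in `n` variables with rational exponents: finite formal sums of terms
`c x^q`, `q ∈ ℚⁿ`, with `x^p x^q = x^(p+q)`. -/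
abbrev RatPoly (n : ℕ) : Type := AddMonoidAlgebra ℝ (Fin n → ℚ)

/-- The term `c x^q`. -/
noncomputable def term {n : ℕ} (q : Fin n → ℚ) (c : ℝ) : RatPoly n := AddMonoidAlgebra.single q c

/-- A polynomial, seen as a polynomial with rational exponents. -/
noncomputable def toRatPoly {n : ℕ} (f : MvPolynomial (Fin n) ℝ) : RatPoly n :=
  ∑ α ∈ f.support, term (ratPt α) (f.coeff α)

end SONC

/-! Both (i) and (ii) are equivalent to one condition on exponential sums. Substitute `x = exp y`,
and replace the coefficient `c` at each exponent that is not even by `-|c|`, its value in the worst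
orthant; this is `signed`. The condition is that the result is SAGE: a sum of nonnegative
signomials, each with at most one negative coefficient.

Necessity is termwise. A nonnegative circuit polynomial and a binomial square along a midpoint with
even endpoints both become SAGE. The triangle inequality makes `signed (g + h)` dominate `signed g +
signed h` coefficientwise, so the property passes to sums (`IsSAGE.signed_add`).

For sufficiency, a SAGE decomposition is first rearranged so that no cancellation occurs between
summands (`IsSAGE.exists_sign_preserving`). Each `β ∈ Γ(f)` then owns one summand, whose other
exponents lie in `Λ(f)`. Its nonnegativity has a relative entropy certificate `ν`, a nonnegative
measure on `Λ(f)` which, when nonzero, has barycentre `β` (`exists_relEntropy_certificate`).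
Carathéodory's theorem splits `ν` over simplices around `β`, and the summand splits with it into
circuit polynomials satisfying the weighted AM-GM bound, up to nonnegative remainders at points of
`Λ(f)` (`HasCircuitDecomposition.of_isSAGE`). AM-GM then gives (i).

To obtain (ii), run the random walk on `M_{Tβ}` from `β` that steps from `u` to `v_u` or `w_u` with
probability 1/2 and stops on `T`. Affine independence of `T` forces its exit law to be the
barycentric coordinates of `β`. Weighting the midpoint relations at `u` by the expected number of
visits telescopes to the circuit polynomial, and each summand is a positive semidefinite binary
form, hence a sum of two binomial squares (`circuit_mem_binomialCone`). Nonnegative remainders at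
vertices of circuits are absorbed as degenerate forms; those at `Ã` are the last sum in (ii).

The sets `M_{Tβ}` are obtained by adding `β` to the points of `conv T` in a fine grid `(2/N)ℤⁿ` with
`N` odd. -/

namespace SONC

/-! ### Sums of AGE signomials and sign-preserving decompositions -/

/-- The value at `exp y` of the signomial with coefficients `g`. -/
noncomputable def expEval {n : ℕ} (y : Fin n → ℝ) : ((Fin n → ℚ) →₀ ℝ) →ₗ[ℝ] ℝ :=
  Finsupp.linearCombination ℝ (fun q => Real.exp (∑ i, (q i : ℝ) * y i))

/-- Nonnegative signomials whose coefficients away from the exponent `k` are nonnegative. -/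
def IsAGE {n : ℕ} (k : Fin n → ℚ) (g : (Fin n → ℚ) →₀ ℝ) : Prop :=
  (∀ j, j ≠ k → 0 ≤ g j) ∧ ∀ y, 0 ≤ expEval y g

/-- Finite sums of AGE signomials. -/
def IsSAGE {n : ℕ} (F : (Fin n → ℚ) →₀ ℝ) : Prop :=
  ∃ (S : Finset (Fin n → ℚ)) (g : (Fin n → ℚ) → (Fin n → ℚ) →₀ ℝ),
    (∀ k, IsAGE k (g k)) ∧ (∀ k, k ∉ S → g k = 0) ∧ F = ∑ k ∈ S, g k

variable {n : ℕ}

theorem expEval_single (y : Fin n → ℝ) (q : Fin n → ℚ) (c : ℝ) :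
    expEval y (Finsupp.single q c) = c * Real.exp (∑ i, (q i : ℝ) * y i) := by
  simp [expEval]

theorem expEval_nonneg (y : Fin n → ℝ) {g : (Fin n → ℚ) →₀ ℝ} (h : ∀ q, 0 ≤ g q) :
    0 ≤ expEval y g := by
  rw [expEval, Finsupp.linearCombination_apply, Finsupp.sum]
  exact Finset.sum_nonneg fun q _ => mul_nonneg (h q) (Real.exp_pos _).le

theorem IsAGE.of_nonneg (k : Fin n → ℚ) {g : (Fin n → ℚ) →₀ ℝ} (h : ∀ q, 0 ≤ g q) : IsAGE k g :=
  ⟨fun j _ => h j, fun y => expEval_nonneg y h⟩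

theorem IsAGE.zero (k : Fin n → ℚ) : IsAGE k 0 := .of_nonneg k (by simp)

theorem IsAGE.add {k : Fin n → ℚ} {g h : (Fin n → ℚ) →₀ ℝ} (hg : IsAGE k g) (hh : IsAGE k h) :
    IsAGE k (g + h) :=
  ⟨fun j hj => add_nonneg (hg.1 j hj) (hh.1 j hj),
    fun y => by rw [map_add]; exact add_nonneg (hg.2 y) (hh.2 y)⟩

theorem IsAGE.smul {k : Fin n → ℚ} {g : (Fin n → ℚ) →₀ ℝ} (hg : IsAGE k g) {t : ℝ} (ht : 0 ≤ t) :
    IsAGE k (t • g) :=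
  ⟨fun j hj => mul_nonneg ht (hg.1 j hj),
    fun y => by rw [map_smul]; exact mul_nonneg ht (hg.2 y)⟩

theorem IsAGE.isSAGE {k : Fin n → ℚ} {g : (Fin n → ℚ) →₀ ℝ} (hg : IsAGE k g) : IsSAGE g := by
  classical
  refine ⟨{k}, fun j => if j = k then g else 0, fun j => ?_, fun j hj => ?_, by simp⟩
  · by_cases h : j = k
    · subst h; simpa using hg
    · simpa [h] using IsAGE.zero j
  · simp at hj; simp [hj]

theorem IsSAGE.of_nonneg {g : (Fin n → ℚ) →₀ ℝ} (h : ∀ q, 0 ≤ g q) : IsSAGE g :=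
  (IsAGE.of_nonneg 0 h).isSAGE

theorem IsSAGE.add {F G : (Fin n → ℚ) →₀ ℝ} (hF : IsSAGE F) (hG : IsSAGE G) :
    IsSAGE (F + G) := by
  classical
  obtain ⟨S, g, hg, hS, rfl⟩ := hF
  obtain ⟨S', g', hg', hS', rfl⟩ := hG
  refine ⟨S ∪ S', fun k => g k + g' k, fun k => (hg k).add (hg' k), fun k hk => ?_, ?_⟩
  · simp only [Finset.mem_union, not_or] at hk
    simp [hS k hk.1, hS' k hk.2]
  · rw [Finset.sum_add_distrib]
    congr 1
    · exact Finset.sum_subset Finset.subset_union_left fun k _ hk => hS k hk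
    · exact Finset.sum_subset Finset.subset_union_right fun k _ hk => hS' k hk

/-- Elimination of the unneeded sign changes at the exponent `k`. -/
theorem sage_elimination_step (S U : Finset (Fin n → ℚ)) (g : (Fin n → ℚ) → (Fin n → ℚ) →₀ ℝ)
    (hg : ∀ k, IsAGE k (g k)) (hS : ∀ k, k ∉ S → g k = 0) (hU : ∀ j, (g j).support ⊆ U)
    (k : Fin n → ℚ) :
    ∃ g' : (Fin n → ℚ) → (Fin n → ℚ) →₀ ℝ, (∀ k, IsAGE k (g' k)) ∧ (∀ k, k ∉ S → g' k = 0) ∧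
      (∀ j, (g' j).support ⊆ U) ∧ ∑ k ∈ S, g' k = ∑ k ∈ S, g k ∧
      (∀ k', k' ≠ k → (∀ j, 0 ≤ g j k') → ∀ j, 0 ≤ g' j k') ∧
      (∀ k', k' ≠ k → (∀ j, j ≠ k' → g j k' = 0) → ∀ j, j ≠ k' → g' j k' = 0) ∧
      (0 ≤ (∑ j ∈ S, g j) k → ∀ j, 0 ≤ g' j k) ∧
      ((∑ j ∈ S, g j) k < 0 → ∀ j, j ≠ k → g' j k = 0) := by
  classical
  have hsum : ∀ h : (Fin n → ℚ) → (Fin n → ℚ) →₀ ℝ, (∑ j ∈ S, h j) k = ∑ j ∈ S, h j k :=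
    fun h => by simp [Finsupp.finsetSum_apply]
  by_cases ha : 0 ≤ g k k
  · have hnn : ∀ j, 0 ≤ g j k := fun j => by
      by_cases h : k = j
      · exact h ▸ ha
      · exact (hg j).1 k h
    refine ⟨g, hg, hS, hU, rfl, fun _ _ h => h, fun _ _ h => h, fun _ => hnn, fun h => ?_⟩
    rw [hsum] at h
    exact absurd h (not_lt.2 (Finset.sum_nonneg fun j _ => hnn j))
  push Not at ha
  have hkS : k ∈ S := by
    by_contra h
    simp [hS k h] at ha
  have hnn : ∀ j, j ≠ k → 0 ≤ g j k := fun j hj => (hg j).1 k (Ne.symm hj)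
  set s := ∑ j ∈ S.erase k, g j k with hs
  have hs0 : 0 ≤ s := Finset.sum_nonneg fun j hj => hnn j (Finset.ne_of_mem_erase hj)
  -- The summand `g k` is distributed among the others in proportion to their values at `k`.
  -- Dividing by `m` ensures both that at most all of `g k` is used (`m ≥ s`) and that no `g j`
  -- becomes negative at `k` (`m ≥ -g k k`). If the total at `k` is nonnegative then `m = s` and `g
  -- k` is used up; if it is negative then `m = -g k k` and every other summand is cancelled at `k`.
  set m := max s (-g k k) with hm
  have hm0 : 0 < m := lt_max_of_lt_right (by linarith)
  have hFk : (∑ j ∈ S, g j) k = g k k + s := by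
    rw [hsum, hs, Finset.add_sum_erase S (fun j => g j k) hkS]
  have hl : ∀ j, j ≠ k → 0 ≤ g j k / m := fun j hj => div_nonneg (hnn j hj) hm0.le
  have hsm : 0 ≤ 1 - s / m := by
    rw [sub_nonneg, div_le_one hm0]; exact le_max_left _ _
  refine ⟨fun j => if j = k then (1 - s / m) • g k else g j + (g j k / m) • g k,
    fun j => ?_, fun j hj => ?_, fun j => ?_, ?_, fun k' hk' h j => ?_, fun k' hk' h j hj => ?_,
    fun h j => ?_, fun h j hj => ?_⟩
  · by_cases h : j = k
    · subst h; simpa using (hg j).smul hsm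
    · simp only [h, if_false]
      refine ⟨fun i hi => ?_, fun y => ?_⟩
      · by_cases hik : i = k
        · subst hik
          have : g j i + g j i / m * g i i = g j i * ((m + g i i) / m) := by
            field_simp
          simp only [Finsupp.add_apply, Finsupp.smul_apply, smul_eq_mul, this]
          have : -g i i ≤ m := le_max_right _ _
          exact mul_nonneg (hnn j h) (div_nonneg (by linarith) hm0.le)
        · exact add_nonneg ((hg j).1 i hi) (mul_nonneg (hl j h) ((hg k).1 i hik))
      · rw [map_add, map_smul]
        exact add_nonneg ((hg j).2 y) (mul_nonneg (hl j h) ((hg k).2 y))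
  · have h : j ≠ k := fun h => hj (h ▸ hkS)
    simp [h, hS j hj]
  · by_cases h : j = k
    · simp only [h, if_true]
      exact Finsupp.support_smul.trans (hU k)
    · simp only [h, if_false]
      exact Finsupp.support_add.trans
        (Finset.union_subset (hU j) (Finsupp.support_smul.trans (hU k)))
  · rw [← Finset.add_sum_erase S _ hkS, ← Finset.add_sum_erase S g hkS]
    have : ∑ j ∈ S.erase k, (if j = k then (1 - s / m) • g k else g j + (g j k / m) • g k) =
        ∑ j ∈ S.erase k, g j + (s / m) • g k := by
      rw [hs, Finset.sum_div, Finset.sum_smul, ← Finset.sum_add_distrib]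
      exact Finset.sum_congr rfl fun j hj => by simp [Finset.ne_of_mem_erase hj]
    rw [this, if_pos rfl, sub_smul, one_smul]
    abel
  · by_cases hj : j = k
    · simp only [hj, if_true]
      exact mul_nonneg hsm (h k)
    · simp only [hj, if_false]
      exact add_nonneg (h j) (mul_nonneg (hl j hj) (h k))
  -- At an exponent `k'` already treated, `g k` vanishes, so adding multiples of it leaves the other
  -- summands unchanged there.
  · have hk0 := h k (Ne.symm hk')
    by_cases hjk : j = k
    · simp [hjk, hk0]
    · simp [hjk, hk0, h j hj]
  · have hms : m = s := max_eq_left (by linarith)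
    by_cases hj : j = k
    · have : s / m = 1 := by rw [hms]; exact div_self (by linarith)
      simp [hj, this]
    · simp only [hj, if_false, Finsupp.add_apply, Finsupp.smul_apply, smul_eq_mul]
      have : g j k + g j k / m * g k k = g j k * ((m + g k k) / m) := by field_simp
      rw [this]
      have : -g k k ≤ m := le_max_right _ _
      exact mul_nonneg (hnn j hj) (div_nonneg (by linarith) hm0.le)
  · have hms : m = -g k k := max_eq_right (by linarith)
    simp only [hj, if_false, Finsupp.add_apply, Finsupp.smul_apply, smul_eq_mul]
    rw [hms]
    field_simp [ha.ne]
    ring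

/-- Exponents are treated one at a time: the elimination step at `k` preserves what was gained at
the earlier ones and creates no exponent outside the finite set `U`. -/
theorem IsSAGE.exists_sign_preserving {F : (Fin n → ℚ) →₀ ℝ} (hF : IsSAGE F) :
    ∃ (S : Finset (Fin n → ℚ)) (g : (Fin n → ℚ) → (Fin n → ℚ) →₀ ℝ),
      (∀ k, IsAGE k (g k)) ∧ (∀ k, k ∉ S → g k = 0) ∧ F = ∑ k ∈ S, g k ∧
      ∀ k, (0 ≤ F k → ∀ j, 0 ≤ g j k) ∧ (F k < 0 → ∀ j, j ≠ k → g j k = 0) := by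
  classical
  obtain ⟨S, g₀, hg₀, hS₀, hF₀⟩ := hF
  set U : Finset (Fin n → ℚ) := S.biUnion fun j => (g₀ j).support with hU
  suffices H : ∀ W : Finset (Fin n → ℚ), ∃ g : (Fin n → ℚ) → (Fin n → ℚ) →₀ ℝ,
      (∀ k, IsAGE k (g k)) ∧ (∀ k, k ∉ S → g k = 0) ∧ (∀ j, (g j).support ⊆ U) ∧
      F = ∑ k ∈ S, g k ∧
      ∀ k ∈ W, (0 ≤ F k → ∀ j, 0 ≤ g j k) ∧ (F k < 0 → ∀ j, j ≠ k → g j k = 0) by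
    obtain ⟨g, hg, hS, hgU, hFg, hW⟩ := H U
    refine ⟨S, g, hg, hS, hFg, fun k => ?_⟩
    by_cases hk : k ∈ U
    · exact hW k hk
    · have : ∀ j, g j k = 0 := fun j => by
        by_contra h
        exact hk (hgU j (Finsupp.mem_support_iff.2 h))
      exact ⟨fun _ j => (this j).ge, fun _ j _ => this j⟩
  intro W
  induction W using Finset.induction_on with
  | empty =>
    refine ⟨g₀, hg₀, hS₀, fun j => ?_, hF₀, by simp⟩
    by_cases hj : j ∈ S
    · exact Finset.subset_biUnion_of_mem (fun j => (g₀ j).support) hj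
    · simp [hS₀ j hj]
  | insert k W hk ih =>
    obtain ⟨g, hg, hS, hgU, hFg, hW⟩ := ih
    obtain ⟨g', h1, h2, h3, h4, h5, h6, h7, h8⟩ := sage_elimination_step S U g hg hS hgU k
    refine ⟨g', h1, h2, h3, hFg.trans h4.symm, fun k' hk' => ?_⟩
    by_cases hkk : k' = k
    · subst hkk
      rw [hFg]
      exact ⟨h7, h8⟩
    · have := hW k' ((Finset.mem_insert.1 hk').resolve_left hkk)
      exact ⟨fun h => h5 k' hkk (this.1 h), fun h => h6 k' hkk (this.2 h)⟩

/-! ### Relative entropy certificates -/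

/-- An exponential sum need not attain its infimum. The quadratic penalty makes it coercive; the
conclusions are the critical point equation and the comparison with the value at `0`. -/
theorem exists_penalized_minimizer {ι : Type*} [Fintype ι] (a : ι → Fin n → ℝ) (c : ι → ℝ)
    (hc : ∀ i, 0 < c i) {ε : ℝ} (hε : 0 < ε) :
    ∃ y : Fin n → ℝ, (∀ j, ∑ i, c i * Real.exp (∑ j, a i j * y j) * a i j + ε * y j = 0) ∧
      ∑ i, c i * Real.exp (∑ j, a i j * y j) + ε / 2 * ∑ j, y j ^ 2 ≤ ∑ i, c i := by
  set φ : (Fin n → ℝ) → ℝ :=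
    fun y => ∑ i, c i * Real.exp (∑ j, a i j * y j) + ε / 2 * ∑ j, y j ^ 2 with hφ
  have hcont : Continuous φ := by fun_prop
  have hlower : ∀ y, ε / 2 * ‖y‖ ^ 2 ≤ φ y := fun y => by
    have h1 : 0 ≤ ∑ i, c i * Real.exp (∑ j, a i j * y j) :=
      Finset.sum_nonneg fun i _ => mul_nonneg (hc i).le (Real.exp_pos _).le
    have h2 : ‖y‖ ^ 2 ≤ ∑ j, y j ^ 2 := by
      have h3 : ‖y‖ ≤ Real.sqrt (∑ j, y j ^ 2) := by
        rw [pi_norm_le_iff_of_nonneg (Real.sqrt_nonneg _)]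
        intro j
        rw [Real.norm_eq_abs]
        apply Real.abs_le_sqrt
        exact Finset.single_le_sum (f := fun j => y j ^ 2) (fun j _ => sq_nonneg _)
          (Finset.mem_univ j)
      calc ‖y‖ ^ 2 ≤ Real.sqrt (∑ j, y j ^ 2) ^ 2 := by gcongr
        _ = _ := Real.sq_sqrt (Finset.sum_nonneg fun j _ => sq_nonneg _)
    have := mul_le_mul_of_nonneg_left h2 (half_pos hε).le
    simp only [hφ]
    linarith
  have hlim : Filter.Tendsto φ (Filter.cocompact _) Filter.atTop := by
    refine Filter.tendsto_atTop_mono hlower ?_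
    exact ((Filter.tendsto_pow_atTop two_ne_zero).comp
      (tendsto_norm_cocompact_atTop)).const_mul_atTop (half_pos hε)
  obtain ⟨y, hy⟩ := hcont.exists_forall_le hlim
  refine ⟨y, fun j => ?_, ?_⟩
  · have hd : HasDerivAt (fun t : ℝ => φ (fun k => y k + t * (if k = j then 1 else 0)))
        (∑ i, c i * (Real.exp (∑ k, a i k * (y k + 0 * (if k = j then 1 else 0))) *
            ∑ k, a i k * (1 * (if k = j then 1 else 0))) +
          ε / 2 * ∑ k, (2 : ℕ) * (y k + 0 * (if k = j then 1 else 0)) ^ (2 - 1) *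
            (1 * (if k = j then 1 else 0))) 0 := by
      have hl : ∀ k, HasDerivAt (fun t : ℝ => y k + t * (if k = j then 1 else 0))
          (1 * (if k = j then 1 else 0)) 0 := fun k =>
        ((hasDerivAt_id (0 : ℝ)).mul_const _).const_add _
      refine HasDerivAt.add ?_ ?_
      · refine HasDerivAt.fun_sum fun i _ => HasDerivAt.const_mul _ (HasDerivAt.exp ?_)
        exact HasDerivAt.fun_sum fun k _ => (hl k).const_mul _
      · refine HasDerivAt.const_mul _ (HasDerivAt.fun_sum fun k _ => (hl k).fun_pow 2)
    have hmin : IsLocalMin (fun t : ℝ => φ (fun k => y k + t * (if k = j then 1 else 0))) 0 :=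
      Filter.Eventually.of_forall fun t => by simpa using hy _
    have h0 := hmin.hasDerivAt_eq_zero hd
    simp only [add_zero, mul_ite, mul_one, mul_zero, ite_self, Finset.sum_ite_eq',
      Finset.mem_univ, if_true] at h0
    rw [← h0]
    congr 1
    · exact Finset.sum_congr rfl fun i _ => by ring
    · norm_num; ring
  · simpa [hφ] using hy 0

theorem continuous_relEntropy {ι : Type*} [Fintype ι] (c : ι → ℝ) (hc : ∀ i, 0 < c i) :
    Continuous fun ν : ι → ℝ => ∑ i, ν i * Real.log (ν i / c i) := by
  have : (fun ν : ι → ℝ => ∑ i, ν i * Real.log (ν i / c i)) =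
      fun ν => ∑ i, c i * (ν i / c i * Real.log (ν i / c i)) := by
    funext ν
    refine Finset.sum_congr rfl fun i _ => ?_
    rw [← mul_assoc, mul_div_cancel₀ _ (hc i).ne']
  rw [this]
  refine continuous_finsetSum _ fun i _ => continuous_const.mul ?_
  exact Real.continuous_mul_log.comp ((continuous_apply i).div_const _)

/-- Take `ν i = c i * exp (a i · y)` at a minimizer `y` of the sum penalized by `ε`. The critical
point equation makes the first moments `-ε y`, of size `O(√ε)`, and the relative entropy `-ε |y|²`;
the mass is at least `d` by hypothesis. The `ν` stay in a compact box, and a limit point as `ε → 0`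
is the certificate. -/
theorem exists_relEntropy_certificate_fintype {ι : Type*} [Fintype ι] (a : ι → Fin n → ℝ)
    (c : ι → ℝ) (hc : ∀ i, 0 < c i) (d : ℝ)
    (h : ∀ y : Fin n → ℝ, d ≤ ∑ i, c i * Real.exp (∑ j, a i j * y j)) :
    ∃ ν : ι → ℝ, (∀ i, 0 ≤ ν i) ∧ (∀ j, ∑ i, ν i * a i j = 0) ∧ d ≤ ∑ i, ν i ∧
      ∑ i, ν i * Real.log (ν i / c i) ≤ 0 := by
  set K := ∑ i, c i with hK
  have approx : ∀ k : ℕ, ∃ ν : ι → ℝ, ν ∈ Set.pi Set.univ (fun _ => Set.Icc 0 K) ∧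
      (∀ j, (∑ i, ν i * a i j) ^ 2 ≤ 2 * K * (1 / ((k : ℝ) + 1))) ∧ d ≤ ∑ i, ν i ∧
      ∑ i, ν i * Real.log (ν i / c i) ≤ 0 := by
    intro k
    set ε : ℝ := 1 / ((k : ℝ) + 1)
    have hε : 0 < ε := Nat.one_div_pos_of_nat
    obtain ⟨y, hy, hyK⟩ := exists_penalized_minimizer a c hc hε
    have hpos : ∀ i, 0 < c i * Real.exp (∑ j, a i j * y j) :=
      fun i => mul_pos (hc i) (Real.exp_pos _)
    have hsq : 0 ≤ ∑ j, y j ^ 2 := Finset.sum_nonneg fun j _ => sq_nonneg _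
    have hlin : ∀ j, ∑ i, c i * Real.exp (∑ j, a i j * y j) * a i j = -(ε * y j) :=
      fun j => eq_neg_of_add_eq_zero_left (hy j)
    have hle : ∑ i, c i * Real.exp (∑ j, a i j * y j) ≤ K := by
      have := mul_nonneg (half_pos hε).le hsq
      linarith
    refine ⟨fun i => c i * Real.exp (∑ j, a i j * y j), fun i _ => ⟨(hpos i).le, ?_⟩,
      fun j => ?_, h y, ?_⟩
    · exact (Finset.single_le_sum (f := fun i => c i * Real.exp (∑ j, a i j * y j))
        (fun i _ => (hpos i).le) (Finset.mem_univ i)).trans hle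
    · rw [hlin]
      have h1 : y j ^ 2 ≤ ∑ j, y j ^ 2 :=
        Finset.single_le_sum (f := fun j => y j ^ 2) (fun j _ => sq_nonneg _) (Finset.mem_univ j)
      have h2 : 0 ≤ ∑ i, c i * Real.exp (∑ j, a i j * y j) :=
        Finset.sum_nonneg fun i _ => (hpos i).le
      have h3 : ε * y j ^ 2 ≤ 2 * K := by
        have := mul_le_mul_of_nonneg_left h1 hε.le
        linarith
      calc (-(ε * y j)) ^ 2 = ε * y j ^ 2 * ε := by ring
        _ ≤ 2 * K * ε := by gcongr
    · have : ∀ i, Real.log (c i * Real.exp (∑ j, a i j * y j) / c i) = ∑ j, a i j * y j :=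
        fun i => by rw [mul_div_cancel_left₀ _ (hc i).ne', Real.log_exp]
      simp only [this, Finset.mul_sum]
      rw [Finset.sum_comm]
      have h1 : ∀ j, ∑ i, c i * Real.exp (∑ j, a i j * y j) * (a i j * y j) =
          -(ε * y j ^ 2) := fun j => by
        calc _ = (∑ i, c i * Real.exp (∑ j, a i j * y j) * a i j) * y j := by
              rw [Finset.sum_mul]; exact Finset.sum_congr rfl fun i _ => by ring
          _ = _ := by rw [hlin]; ring
      simp only [h1, Finset.sum_neg_distrib, ← Finset.mul_sum]
      have := mul_nonneg hε.le hsq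
      linarith
  choose ν hν using approx
  obtain ⟨ν₀, hν₀, θ, hθ, hlim⟩ :=
    (isCompact_univ_pi fun _ : ι => isCompact_Icc).tendsto_subseq fun k => (hν k).1
  refine ⟨ν₀, fun i => (hν₀ i (Set.mem_univ i)).1, fun j => ?_, ?_, ?_⟩
  · have h1 : Continuous fun ν : ι → ℝ => (∑ i, ν i * a i j) ^ 2 := by fun_prop
    have h2 : Filter.Tendsto (fun k : ℕ => 2 * K * (1 / ((θ k : ℝ) + 1))) Filter.atTop
        (nhds (2 * K * 0)) :=
      ((tendsto_one_div_add_atTop_nhds_zero_nat (𝕜 := ℝ)).comp hθ.tendsto_atTop).const_mul _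
    have h3 := le_of_tendsto_of_tendsto' ((h1.tendsto ν₀).comp hlim) h2
      fun k => (hν (θ k)).2.1 j
    rw [mul_zero] at h3
    exact pow_eq_zero_iff two_ne_zero |>.1 (le_antisymm h3 (sq_nonneg _))
  · have h1 : Continuous fun ν : ι → ℝ => ∑ i, ν i := by fun_prop
    exact ge_of_tendsto' ((h1.tendsto ν₀).comp hlim) fun k => (hν (θ k)).2.2.1
  · exact le_of_tendsto' (((continuous_relEntropy c hc).tendsto ν₀).comp hlim)
      fun k => (hν (θ k)).2.2.2

theorem exists_relEntropy_certificate {ι : Type*} (s : Finset ι) (a : ι → Fin n → ℝ)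
    (c : ι → ℝ) (hc : ∀ i ∈ s, 0 < c i) (d : ℝ)
    (h : ∀ y : Fin n → ℝ, d ≤ ∑ i ∈ s, c i * Real.exp (∑ j, a i j * y j)) :
    ∃ ν : ι → ℝ, (∀ i, 0 ≤ ν i) ∧ (∀ j, ∑ i ∈ s, ν i * a i j = 0) ∧ d ≤ ∑ i ∈ s, ν i ∧
      ∑ i ∈ s, ν i * Real.log (ν i / c i) ≤ 0 := by
  classical
  obtain ⟨ν, h1, h2, h3, h4⟩ := exists_relEntropy_certificate_fintype (fun i : s => a i)
    (fun i : s => c i) (fun i => hc i i.2) d fun y => by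
      rw [Finset.sum_coe_sort s fun i => c i * Real.exp (∑ j, a i j * y j)]
      exact h y
  have hext : ∀ i : s, (if hi : (i : ι) ∈ s then ν ⟨i, hi⟩ else 0) = ν i := fun i => by simp
  refine ⟨fun i => if hi : i ∈ s then ν ⟨i, hi⟩ else 0, fun i => ?_, fun j => ?_, ?_, ?_⟩
  · dsimp only
    split_ifs with hi
    exacts [h1 _, le_rfl]
  · refine Eq.trans ?_ (h2 j)
    rw [← Finset.sum_coe_sort s]
    exact Finset.sum_congr rfl fun i _ => by simp only [hext]
  · refine h3.trans_eq ?_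
    rw [← Finset.sum_coe_sort s]
    exact Finset.sum_congr rfl fun i _ => (hext i).symm
  · refine le_of_eq_of_le ?_ h4
    rw [← Finset.sum_coe_sort s]
    exact Finset.sum_congr rfl fun i _ => by simp only [hext]

/-! ### Splitting a measure over simplices -/

/-- This is Carathéodory's theorem, with the simplex indexed by a subset of the original index set.
-/
theorem exists_affineIndependent_weights {ι E : Type*} [DecidableEq ι] [AddCommGroup E]
    [Module ℝ E] (s : Finset ι) (p : ι → E) (b : E) (ν : ι → ℝ) (hν : ∀ i ∈ s, 0 < ν i)
    (hs : s.Nonempty) (hb : ∑ i ∈ s, ν i • (p i - b) = 0) :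
    ∃ (T : Finset ι) (μ : ι → ℝ), T ⊆ s ∧ T.Nonempty ∧ AffineIndependent ℝ (fun i : T => p i) ∧
      (∀ i ∈ T, 0 < μ i) ∧ (∀ i, i ∉ T → μ i = 0) ∧ ∑ i ∈ T, μ i • (p i - b) = 0 := by
  have hD : 0 < ∑ i ∈ s, ν i := Finset.sum_pos hν hs
  have hmem : b ∈ convexHull ℝ (p '' (s : Set ι)) := by
    have : b = s.centerMass ν p := by
      rw [Finset.centerMass]
      simp only [smul_sub, Finset.sum_sub_distrib, ← Finset.sum_smul] at hb
      rw [sub_eq_zero.1 hb, smul_smul, inv_mul_cancel₀ hD.ne', one_smul]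
    rw [this]
    exact s.centerMass_mem_convexHull (fun i hi => (hν i hi).le) hD
      fun i hi => Set.mem_image_of_mem p hi
  obtain ⟨κ, _, z, w, hz, hzi, hw, hw1, hwb⟩ := eq_pos_convex_span_of_mem_convexHull hmem
  choose f hf hfz using fun k => hz (Set.mem_range_self k)
  have hfi : Function.Injective f := fun k l hkl => hzi.injective (by rw [← hfz, ← hfz, hkl])
  set T : Finset ι := Finset.univ.image f with hT
  have hfT : ∀ k, f k ∈ T := fun k => Finset.mem_image_of_mem f (Finset.mem_univ k)
  let e : κ ≃ T := Equiv.ofBijective (fun k => ⟨f k, hfT k⟩)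
    ⟨fun k l hkl => hfi (congrArg Subtype.val hkl), fun ⟨i, hi⟩ => by
      obtain ⟨k, -, rfl⟩ := Finset.mem_image.1 hi
      exact ⟨k, rfl⟩⟩
  have hext : ∀ k, Function.extend f w 0 (f k) = w k := fun k => hfi.extend_apply w 0 k
  have hne : (Finset.univ : Finset κ).Nonempty := by
    rw [Finset.nonempty_iff_ne_empty]
    intro h
    rw [h] at hw1
    simp at hw1
  refine ⟨T, Function.extend f w 0, fun i hi => ?_, hne.image f, ?_, fun i hi => ?_,
    fun i hi => ?_, ?_⟩
  · obtain ⟨k, -, rfl⟩ := Finset.mem_image.1 hi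
    exact hf k
  · have hze : (fun i : T => p i) ∘ e = z := funext hfz
    rwa [← affineIndependent_equiv e, hze]
  · obtain ⟨k, -, rfl⟩ := Finset.mem_image.1 hi
    rw [hext]
    exact hw k
  · rw [Function.extend_apply' _ _ _ fun ⟨k, hk⟩ => hi (hk ▸ hfT k)]
    rfl
  · rw [hT, Finset.sum_image fun k _ l _ h => hfi h]
    simp only [hext, hfz, smul_sub, Finset.sum_sub_distrib, ← Finset.sum_smul, hw1, hwb, one_smul,
      sub_self]

/-- A nonnegative vector of weights splits into weights on affinely independent sets with the same
barycentre. -/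
theorem exists_simplicial_decomposition {ι E : Type*} [DecidableEq ι] [AddCommGroup E]
    [Module ℝ E] (Λ : Finset ι) (p : ι → E) (b : E) (ν : ι → ℝ) (hν : ∀ i ∈ Λ, 0 ≤ ν i)
    (hb : ∑ i ∈ Λ, ν i • (p i - b) = 0) :
    ∃ κ : Finset ι → ι → ℝ, (∀ i ∈ Λ, ∑ T ∈ Λ.powerset, κ T i = ν i) ∧
      ∀ T ∈ Λ.powerset, (∀ i, κ T i = 0) ∨ (T.Nonempty ∧
        AffineIndependent ℝ (fun i : T => p i) ∧ (∀ i ∈ T, 0 < κ T i) ∧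
        (∀ i, i ∉ T → κ T i = 0) ∧ ∑ i ∈ T, κ T i • (p i - b) = 0) := by
  induction hm : (Λ.filter fun i => ν i ≠ 0).card using Nat.strong_induction_on generalizing ν with
  | _ m ih =>
  subst hm
  set s := Λ.filter fun i => ν i ≠ 0 with hs
  have hsΛ : s ⊆ Λ := Finset.filter_subset _ _
  by_cases hne : s.Nonempty
  swap
  · refine ⟨fun _ _ => 0, fun i hi => ?_, fun T _ => Or.inl fun _ => rfl⟩
    rw [Finset.not_nonempty_iff_eq_empty, hs, Finset.filter_eq_empty_iff] at hne
    simpa using (not_not.1 (hne hi)).symm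
  have hpos : ∀ i ∈ s, 0 < ν i := fun i hi =>
    lt_of_le_of_ne (hν i (hsΛ hi)) (Ne.symm (Finset.mem_filter.1 hi).2)
  obtain ⟨T, μ, hTs, hTne, hTi, hμ, hμ0, hμb⟩ := exists_affineIndependent_weights s p b ν hpos hne
    (by
      rw [← hb]
      refine Finset.sum_subset hsΛ fun i hi his => ?_
      have : ν i = 0 := by
        by_contra h
        exact his (Finset.mem_filter.2 ⟨hi, h⟩)
      simp [this])
  obtain ⟨i₀, hi₀, hmin⟩ := T.exists_min_image (fun i => ν i / μ i) hTne
  -- The largest multiple of `μ` that can be subtracted from `ν`: it removes `i₀` from the support,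
  -- on whose size the induction runs.
  set t := ν i₀ / μ i₀ with ht
  have ht0 : 0 < t := div_pos (hpos i₀ (hTs hi₀)) (hμ i₀ hi₀)
  have hTΛ : T ⊆ Λ := hTs.trans hsΛ
  have hsub : ∀ i ∈ Λ, 0 ≤ ν i - t * μ i := fun i hi => by
    by_cases hiT : i ∈ T
    · have := (le_div_iff₀ (hμ i hiT)).1 (hmin i hiT)
      linarith
    · simpa [hμ0 i hiT] using hν i hi
  have hμΛ : ∑ i ∈ Λ, μ i • (p i - b) = 0 := by
    rw [← hμb]
    exact (Finset.sum_subset hTΛ fun i _ hi => by simp [hμ0 i hi]).symm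
  have hlt : (Λ.filter fun i => ν i - t * μ i ≠ 0) ⊂ s := by
    refine Finset.ssubset_iff_of_subset (fun i hi => ?_) |>.2 ⟨i₀, hTs hi₀, fun h => ?_⟩
    · obtain ⟨h1, h2⟩ := Finset.mem_filter.1 hi
      refine Finset.mem_filter.2 ⟨h1, fun h => h2 ?_⟩
      have hiT : i ∉ T := fun hiT => (Finset.mem_filter.1 (hTs hiT)).2 h
      simp [h, hμ0 i hiT]
    · refine (Finset.mem_filter.1 h).2 ?_
      rw [ht, div_mul_cancel₀ _ (hμ i₀ hi₀).ne', sub_self]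
  obtain ⟨κ, hκ, hκT⟩ := ih _ (Finset.card_lt_card hlt) (fun i => ν i - t * μ i) hsub
    (by simp only [sub_smul, mul_smul, Finset.sum_sub_distrib, hb, ← Finset.smul_sum, hμΛ,
        smul_zero, sub_zero]) rfl
  refine ⟨fun T' i => κ T' i + if T' = T then t * μ i else 0, fun i hi => ?_, fun T' hT' => ?_⟩
  · rw [Finset.sum_add_distrib, hκ i hi, Finset.sum_ite_eq',
      if_pos (Finset.mem_powerset.2 hTΛ)]
    ring
  · by_cases hTT : T' = T
    · subst hTT
      right
      simp only [if_true]
      rcases hκT T' hT' with h | ⟨-, -, h1, h2, h3⟩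
      · simp only [h, zero_add]
        refine ⟨hTne, hTi, fun i hi => mul_pos ht0 (hμ i hi), fun i hi => by simp [hμ0 i hi], ?_⟩
        simp only [mul_smul, ← Finset.smul_sum, hμb, smul_zero]
      · refine ⟨hTne, hTi, fun i hi => add_pos (h1 i hi) (mul_pos ht0 (hμ i hi)),
          fun i hi => by simp [h2 i hi, hμ0 i hi], ?_⟩
        simp only [add_smul, Finset.sum_add_distrib, h3, mul_smul, ← Finset.smul_sum, hμb,
          smul_zero, add_zero]
    · simpa [hTT] using hκT T' hT'

/-! ### From one AGE signomial to circuits -/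

/-- The circuit polynomial `∑_{α ∈ T} C α x^α - D x^β` satisfies the weighted arithmetic-geometric
mean bound for some barycentric coordinates of `β`. -/
def CircuitBound (T : Finset (Fin n →₀ ℕ)) (β : Fin n →₀ ℕ) (C : (Fin n →₀ ℕ) → ℝ) (D : ℝ) :
    Prop :=
  ∃ wt : (Fin n →₀ ℕ) → ℝ, (∀ α ∈ T, 0 < wt α) ∧ ∑ α ∈ T, wt α = 1 ∧
    realPt β = ∑ α ∈ T, wt α • realPt α ∧ (∀ α ∈ T, 0 < C α) ∧ 0 ≤ D ∧
    D ≤ Real.exp (∑ α ∈ T, wt α * Real.log (C α / wt α))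

/-- Normalizing `κ` by its mass `K` gives the barycentric coordinates `κ α / K`. With `C α = κ α * c
α / ν α` the ratio of `C α` to its coordinate is `K / (ν α / c α)`, so the AM-GM constant is exactly
the bound on `D`. -/
theorem circuitBound_of_weights {T : Finset (Fin n →₀ ℕ)} {β : Fin n →₀ ℕ}
    {κ ν c : (Fin n →₀ ℕ) → ℝ} (hT : T.Nonempty) (hκ : ∀ α ∈ T, 0 < κ α) (hν : ∀ α ∈ T, 0 < ν α)
    (hc : ∀ α ∈ T, 0 < c α) (hb : ∑ α ∈ T, κ α • (realPt α - realPt β) = 0) {D : ℝ} (hD0 : 0 ≤ D)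
    (hD : D ≤ (∑ α ∈ T, κ α) *
      Real.exp (-(∑ α ∈ T, κ α * Real.log (ν α / c α)) / ∑ α ∈ T, κ α)) :
    CircuitBound T β (fun α => κ α * (c α / ν α)) D := by
  set K := ∑ α ∈ T, κ α with hK
  have hK0 : 0 < K := Finset.sum_pos hκ hT
  have hwt1 : ∑ α ∈ T, κ α / K = 1 := by rw [← Finset.sum_div]; exact div_self hK0.ne'
  refine ⟨fun α => κ α / K, fun α hα => div_pos (hκ α hα) hK0, hwt1, ?_,
    fun α hα => mul_pos (hκ α hα) (div_pos (hc α hα) (hν α hα)), hD0, ?_⟩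
  · simp only [smul_sub, Finset.sum_sub_distrib, ← Finset.sum_smul] at hb
    simp only [div_eq_inv_mul, mul_smul, ← Finset.smul_sum]
    rw [sub_eq_zero.1 hb, smul_smul, inv_mul_cancel₀ hK0.ne', one_smul]
  · refine hD.trans_eq ?_
    have : ∑ α ∈ T, κ α / K * Real.log (κ α * (c α / ν α) / (κ α / K)) =
        ∑ α ∈ T, (κ α / K * Real.log K - κ α * Real.log (ν α / c α) / K) := by
      refine Finset.sum_congr rfl fun α hα => ?_
      have h1 := hκ α hα
      have h2 := hν α hα
      have h3 := hc α hα
      have h4 : κ α * (c α / ν α) / (κ α / K) = K / (ν α / c α) := by field_simp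
      rw [h4, Real.log_div hK0.ne' (div_pos h2 h3).ne']
      ring
    rw [this, Finset.sum_sub_distrib, ← Finset.sum_mul, hwt1, one_mul, Real.exp_sub,
      Real.exp_log hK0, ← Finset.sum_div, neg_div, Real.exp_neg]
    rfl

/-- The certificate `ν` is split as `∑ κ T`, and `c` is shared in the same proportions. A simplex of
mass `K T` and entropy part `s T` can carry `E T = K T * exp (-s T / K T) ≥ K T - s T`. Summing, the
capacities total at least the mass of `ν` minus its entropy, hence at least `d`. -/
theorem exists_circuit_decomposition_of_pos (Λ : Finset (Fin n →₀ ℕ)) (c : (Fin n →₀ ℕ) → ℝ)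
    (hc : ∀ α ∈ Λ, 0 < c α) (β : Fin n →₀ ℕ) {d : ℝ} (hd : 0 < d)
    (h : ∀ y : Fin n → ℝ, d * Real.exp (∑ i, (β i : ℝ) * y i) ≤
      ∑ α ∈ Λ, c α * Real.exp (∑ i, (α i : ℝ) * y i)) :
    ∃ (C : Finset (Fin n →₀ ℕ) → (Fin n →₀ ℕ) → ℝ) (D : Finset (Fin n →₀ ℕ) → ℝ),
      (∀ α ∈ Λ, ∑ T ∈ Λ.powerset, C T α ≤ c α) ∧ ∑ T ∈ Λ.powerset, D T = d ∧
      ∀ T ∈ Λ.powerset, ((∀ α, C T α = 0) ∧ D T = 0) ∨ (T.Nonempty ∧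
        AffineIndependent ℝ (fun α : T => realPt (α : Fin n →₀ ℕ)) ∧ (∀ α, α ∉ T → C T α = 0) ∧
        CircuitBound T β (C T) (D T)) := by
  classical
  obtain ⟨ν, hν0, hνb, hνd, hνe⟩ := exists_relEntropy_certificate Λ
    (fun α i => realPt α i - realPt β i) c hc d fun y => by
      have h1 := mul_le_mul_of_nonneg_right (h y) (Real.exp_pos (-∑ i, (β i : ℝ) * y i)).le
      rw [mul_assoc, ← Real.exp_add, add_neg_cancel, Real.exp_zero, mul_one,
        Finset.sum_mul] at h1
      refine h1.trans_eq (Finset.sum_congr rfl fun α _ => ?_)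
      rw [mul_assoc, ← Real.exp_add, ← sub_eq_add_neg, ← Finset.sum_sub_distrib]
      simp only [realPt, sub_mul]
  obtain ⟨κ, hκν, hκ⟩ := exists_simplicial_decomposition Λ realPt (realPt β) ν (fun α _ => hν0 α)
    (by
      funext j
      simpa [Finset.sum_apply] using hνb j)
  have hκ0 : ∀ T ∈ Λ.powerset, ∀ α, 0 ≤ κ T α := fun T hT α => by
    rcases hκ T hT with h | ⟨-, -, h1, h2, -⟩
    · exact (h α).ge
    · by_cases hα : α ∈ T
      exacts [(h1 α hα).le, (h2 α hα).ge]
  set K : Finset (Fin n →₀ ℕ) → ℝ := fun T => ∑ α ∈ T, κ T α with hK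
  set s : Finset (Fin n →₀ ℕ) → ℝ := fun T => ∑ α ∈ T, κ T α * Real.log (ν α / c α) with hs
  have hext : ∀ T ∈ Λ.powerset, ∀ φ : (Fin n →₀ ℕ) → ℝ,
      ∑ α ∈ T, κ T α * φ α = ∑ α ∈ Λ, κ T α * φ α := fun T hT φ => by
    refine Finset.sum_subset (Finset.mem_powerset.1 hT) fun α _ hα => ?_
    rcases hκ T hT with h | ⟨-, -, -, h2, -⟩
    · simp [h]
    · simp [h2 α hα]
  have hswap : ∀ φ : (Fin n →₀ ℕ) → ℝ,
      ∑ T ∈ Λ.powerset, ∑ α ∈ T, κ T α * φ α = ∑ α ∈ Λ, ν α * φ α := fun φ => by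
    rw [Finset.sum_congr rfl fun T hT => hext T hT φ, Finset.sum_comm]
    exact Finset.sum_congr rfl fun α hα => by rw [← Finset.sum_mul, hκν α hα]
  have hsumK : ∑ T ∈ Λ.powerset, K T = ∑ α ∈ Λ, ν α := by simpa using hswap fun _ => 1
  have hsums : ∑ T ∈ Λ.powerset, s T ≤ 0 := (hswap _).trans_le hνe
  set E : Finset (Fin n →₀ ℕ) → ℝ := fun T => K T * Real.exp (-s T / K T) with hE
  have hK0 : ∀ T ∈ Λ.powerset, 0 ≤ K T := fun T hT => Finset.sum_nonneg fun α _ => hκ0 T hT α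
  have hE0 : ∀ T ∈ Λ.powerset, 0 ≤ E T := fun T hT => mul_nonneg (hK0 T hT) (Real.exp_pos _).le
  have hEK : ∀ T ∈ Λ.powerset, K T - s T ≤ E T := fun T hT => by
    rcases hκ T hT with h | ⟨h0, -, h1, -, -⟩
    · simp [hE, hK, hs, h]
    · have hpos : 0 < K T := Finset.sum_pos h1 h0
      have := mul_le_mul_of_nonneg_left (Real.add_one_le_exp (-s T / K T)) hpos.le
      have h2 : K T * (-s T / K T + 1) = K T - s T := by field_simp; ring
      linarith
  have hsumE : d ≤ ∑ T ∈ Λ.powerset, E T := by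
    have := Finset.sum_le_sum hEK
    rw [Finset.sum_sub_distrib, hsumK] at this
    linarith
  set W := ∑ T ∈ Λ.powerset, E T with hW
  have hW0 : 0 < W := hd.trans_le hsumE
  -- The capacities may exceed `d` in total, so they are scaled down by `d / W ≤ 1`. Where `ν α = 0`
  -- the quotient is `0`, and `α` contributes to no circuit.
  refine ⟨fun T α => κ T α * (c α / ν α), fun T => E T * (d / W), fun α hα => ?_, ?_,
    fun T hT => ?_⟩
  · rw [← Finset.sum_mul, hκν α hα]
    by_cases h0 : ν α = 0
    · simpa [h0] using (hc α hα).le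
    · rw [mul_div_cancel₀ _ h0]
  · rw [← Finset.sum_mul, mul_div_cancel₀ _ hW0.ne']
  · rcases hκ T hT with h | ⟨h0, h1, h2, h3, h4⟩
    · left
      simp [hE, hK, h]
    · right
      have hTΛ := Finset.mem_powerset.1 hT
      refine ⟨h0, h1, fun α hα => by simp [h3 α hα], circuitBound_of_weights h0 h2
        (fun α hα => ?_) (fun α hα => hc α (hTΛ hα)) h4
        (mul_nonneg (hE0 T hT) (div_nonneg hd.le hW0.le)) ?_⟩
      · rw [← hκν α (hTΛ hα)]
        exact (h2 α hα).trans_le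
          (Finset.single_le_sum (f := fun T => κ T α) (fun T hT => hκ0 T hT α) hT)
      · exact mul_le_of_le_one_right (hE0 T hT) ((div_le_one hW0).2 hsumE)

theorem exists_circuit_decomposition (Λ : Finset (Fin n →₀ ℕ)) (c : (Fin n →₀ ℕ) → ℝ)
    (hc : ∀ α ∈ Λ, 0 ≤ c α) (β : Fin n →₀ ℕ) {d : ℝ} (hd : 0 < d)
    (h : ∀ y : Fin n → ℝ, d * Real.exp (∑ i, (β i : ℝ) * y i) ≤
      ∑ α ∈ Λ, c α * Real.exp (∑ i, (α i : ℝ) * y i)) :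
    ∃ (C : Finset (Fin n →₀ ℕ) → (Fin n →₀ ℕ) → ℝ) (D : Finset (Fin n →₀ ℕ) → ℝ),
      (∀ α ∈ Λ, ∑ T ∈ Λ.powerset, C T α ≤ c α) ∧ ∑ T ∈ Λ.powerset, D T = d ∧
      ∀ T ∈ Λ.powerset, ((∀ α, C T α = 0) ∧ D T = 0) ∨ (T.Nonempty ∧
        AffineIndependent ℝ (fun α : T => realPt (α : Fin n →₀ ℕ)) ∧ (∀ α, α ∉ T → C T α = 0) ∧
        CircuitBound T β (C T) (D T)) := by
  classical
  set Λ' := Λ.filter fun α => 0 < c α with hΛ'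
  have hsub : Λ' ⊆ Λ := Finset.filter_subset _ _
  have hzero : ∀ α ∈ Λ, α ∉ Λ' → c α = 0 := fun α hα hα' =>
    le_antisymm (not_lt.1 fun h => hα' (Finset.mem_filter.2 ⟨hα, h⟩)) (hc α hα)
  obtain ⟨C, D, hC, hD, hT⟩ := exists_circuit_decomposition_of_pos Λ' c
    (fun α hα => (Finset.mem_filter.1 hα).2) β hd fun y => (h y).trans_eq
      (Finset.sum_subset hsub fun α hα hα' => by simp [hzero α hα hα']).symm
  have hpw : Λ'.powerset ⊆ Λ.powerset := Finset.powerset_mono.2 hsub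
  refine ⟨fun T α => if T ⊆ Λ' then C T α else 0, fun T => if T ⊆ Λ' then D T else 0,
    fun α hα => ?_, ?_, fun T hTΛ => ?_⟩
  · rw [← Finset.sum_subset hpw fun T _ hT' => if_neg fun h => hT' (Finset.mem_powerset.2 h),
      Finset.sum_congr rfl fun T hT' => if_pos (Finset.mem_powerset.1 hT')]
    by_cases hα' : α ∈ Λ'
    · exact hC α hα'
    · refine (Finset.sum_eq_zero fun T hT' => ?_).trans_le (hc α hα)
      rcases hT T hT' with h | ⟨-, -, h, -⟩
      · exact h.1 α
      · exact h α fun h => hα' (Finset.mem_powerset.1 hT' h)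
  · rw [← Finset.sum_subset hpw fun T _ hT' => if_neg fun h => hT' (Finset.mem_powerset.2 h),
      Finset.sum_congr rfl fun T hT' => if_pos (Finset.mem_powerset.1 hT'), hD]
  · by_cases hT' : T ⊆ Λ'
    · simpa [hT'] using hT T (Finset.mem_powerset.2 hT')
    · simp [hT']

/-! ### Rational exponents, parity and sign normalization -/

/-- Points of `ℚⁿ` whose coordinates have odd denominators and even numerators. -/
def IsEvenRatPt (q : Fin n → ℚ) : Prop := ∀ i, Odd (q i).den ∧ Even (q i).num

theorem odd_den_even_num_iff {x : ℚ} :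
    Odd x.den ∧ Even x.num ↔ ∃ (a : ℤ) (b : ℕ), Odd b ∧ x = 2 * a / b := by
  constructor
  · rintro ⟨h1, a, ha⟩
    refine ⟨a, x.den, h1, ?_⟩
    conv_lhs => rw [← Rat.num_div_den x, ha]
    push_cast
    ring
  · rintro ⟨a, b, hb, hx⟩
    have hb0 : (b : ℚ) ≠ 0 := by exact_mod_cast hb.pos.ne'
    have hdvd : x.den ∣ b := by
      have := Rat.den_dvd (2 * a) b
      rw [Rat.divInt_eq_div] at this
      push_cast at this
      rw [← hx] at this
      exact_mod_cast this
    refine ⟨hb.of_dvd_nat hdvd, ?_⟩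
    have h : x.num * b = 2 * a * x.den := by
      have h1 : (x.num : ℚ) / x.den = 2 * a / b := by rw [Rat.num_div_den, hx]
      rw [div_eq_div_iff (by exact_mod_cast x.den_ne_zero) hb0] at h1
      exact_mod_cast h1
    have h2 : Even (x.num * (b : ℤ)) := by
      rw [h, mul_assoc]; exact even_two_mul _
    rcases Int.even_mul.1 h2 with h3 | h3
    · exact h3
    · exact absurd ((Int.even_coe_nat b).1 h3) (Nat.not_even_iff_odd.2 hb)

theorem isEvenRatPt_ratPt {α : Fin n →₀ ℕ} : IsEvenRatPt (ratPt α) ↔ IsEvenPt α := by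
  simp [IsEvenRatPt, IsEvenPt, ratPt]

theorem IsEvenRatPt.two_smul_sub {u w : Fin n → ℚ} (hu : IsEvenRatPt u) (hw : IsEvenRatPt w) :
    IsEvenRatPt ((2 : ℚ) • u - w) := by
  intro i
  obtain ⟨a, b, hb, hab⟩ := odd_den_even_num_iff.1 (hu i)
  obtain ⟨c, d, hd, hcd⟩ := odd_den_even_num_iff.1 (hw i)
  have hb0 : (b : ℚ) ≠ 0 := by exact_mod_cast hb.pos.ne'
  have hd0 : (d : ℚ) ≠ 0 := by exact_mod_cast hd.pos.ne'
  refine odd_den_even_num_iff.2 ⟨2 * a * d - c * b, b * d, hb.mul hd, ?_⟩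
  simp only [Pi.sub_apply, Pi.smul_apply, smul_eq_mul, hab, hcd]
  push_cast
  field_simp

theorem ratPt_injective : Function.Injective (ratPt : (Fin n →₀ ℕ) → Fin n → ℚ) := by
  intro α β h
  ext i
  have h1 : (α i : ℚ) = β i := congrFun h i
  exact_mod_cast h1

theorem coeff_toRatPoly (f : MvPolynomial (Fin n) ℝ) (α : Fin n →₀ ℕ) :
    (toRatPoly f).coeff (ratPt α) = f.coeff α := by
  classical
  simp only [toRatPoly, term, AddMonoidAlgebra.coeff_sum, AddMonoidAlgebra.coeff_single,
    Finsupp.finsetSum_apply, Finsupp.single_apply, ratPt_injective.eq_iff, Finset.sum_ite_eq']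
  split_ifs with h
  · rfl
  · exact (MvPolynomial.notMem_support_iff.1 h).symm

theorem coeff_toRatPoly_of_notMem (f : MvPolynomial (Fin n) ℝ) {q : Fin n → ℚ}
    (hq : ∀ α ∈ f.support, ratPt α ≠ q) : (toRatPoly f).coeff q = 0 := by
  classical
  simp only [toRatPoly, term, AddMonoidAlgebra.coeff_sum, AddMonoidAlgebra.coeff_single,
    Finsupp.finsetSum_apply, Finsupp.single_apply]
  exact Finset.sum_eq_zero fun α hα => if_neg (hq α hα)

theorem toRatPoly_add (f g : MvPolynomial (Fin n) ℝ) :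
    toRatPoly (f + g) = toRatPoly f + toRatPoly g := by
  ext q
  by_cases h : ∃ α, ratPt α = q
  · obtain ⟨α, rfl⟩ := h
    simp [coeff_toRatPoly]
  · push Not at h
    simp [coeff_toRatPoly_of_notMem _ fun α _ => h α]

theorem toRatPoly_zero : toRatPoly (0 : MvPolynomial (Fin n) ℝ) = 0 := by simp [toRatPoly]

theorem toRatPoly_sum {ι : Type*} (s : Finset ι) (g : ι → MvPolynomial (Fin n) ℝ) :
    toRatPoly (∑ i ∈ s, g i) = ∑ i ∈ s, toRatPoly (g i) :=
  map_sum (⟨⟨toRatPoly, toRatPoly_zero⟩, toRatPoly_add⟩ :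
    MvPolynomial (Fin n) ℝ →+ RatPoly n) g s

theorem toRatPoly_monomial (α : Fin n →₀ ℕ) (c : ℝ) :
    toRatPoly (MvPolynomial.monomial α c) = term (ratPt α) c := by
  classical
  ext q
  by_cases h : ∃ β, ratPt β = q
  · obtain ⟨β, rfl⟩ := h
    rw [coeff_toRatPoly]
    simp [term, Finsupp.single_apply, ratPt_injective.eq_iff, MvPolynomial.coeff_monomial]
  · push Not at h
    rw [coeff_toRatPoly_of_notMem _ fun α _ => h α]
    simp [term, h α]

open Classical in
/-- The signomial obtained by making all the coefficients at exponents that are not even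
nonpositive. -/
noncomputable def signed (h : (Fin n → ℚ) →₀ ℝ) : (Fin n → ℚ) →₀ ℝ :=
  Finsupp.onFinset h.support (fun q => if IsEvenRatPt q then h q else -|h q|) fun q hq => by
    rw [Finsupp.mem_support_iff]
    rintro h0
    simp [h0] at hq

theorem signed_apply_of_even (h : (Fin n → ℚ) →₀ ℝ) {q : Fin n → ℚ} (hq : IsEvenRatPt q) :
    signed h q = h q := by simp [signed, hq]

theorem signed_apply_of_not_even (h : (Fin n → ℚ) →₀ ℝ) {q : Fin n → ℚ} (hq : ¬IsEvenRatPt q) :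
    signed h q = -|h q| := by simp [signed, hq]

/-- The defect of additivity vanishes at even exponents and equals `|g| + |h| - |g + h| ≥ 0` at the
others. -/
theorem IsSAGE.signed_add {g h : (Fin n → ℚ) →₀ ℝ} (hg : IsSAGE (signed g))
    (hh : IsSAGE (signed h)) : IsSAGE (signed (g + h)) := by
  have : signed (g + h) = signed g + signed h + (signed (g + h) - signed g - signed h) := by abel
  rw [this]
  refine (hg.add hh).add (.of_nonneg fun q => ?_)
  by_cases hq : IsEvenRatPt q
  · simp [signed_apply_of_even _ hq]
  · simp only [Finsupp.sub_apply, signed_apply_of_not_even _ hq, Finsupp.add_apply]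
    have := abs_add_le (g q) (h q)
    linarith

theorem IsSAGE.signed_sum {ι : Type*} (s : Finset ι) {F : ι → (Fin n → ℚ) →₀ ℝ}
    (h : ∀ i ∈ s, IsSAGE (signed (F i))) : IsSAGE (signed (∑ i ∈ s, F i)) :=
  Finset.sum_induction F (fun F => IsSAGE (signed F)) (fun _ _ => IsSAGE.signed_add)
    (.of_nonneg fun q => by simp [signed]) h

/-- If `u` is even, normalization changes nothing and the bound for `r` suffices. Otherwise the
coefficient becomes `-|r|`, which is why the bound for `-r` is also required. -/
theorem IsSAGE.signed_sub_single {P : (Fin n → ℚ) →₀ ℝ} (hP : ∀ q, 0 ≤ P q)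
    (hPe : ∀ q, ¬IsEvenRatPt q → P q = 0) (u : Fin n → ℚ) (r : ℝ)
    (he : ∀ y : Fin n → ℝ, r * Real.exp (∑ i, (u i : ℝ) * y i) ≤ expEval y P)
    (ho : ¬IsEvenRatPt u → ∀ y : Fin n → ℝ, -r * Real.exp (∑ i, (u i : ℝ) * y i) ≤ expEval y P) :
    IsSAGE (signed (P - Finsupp.single u r)) := by
  classical
  have hkey : ∀ t : ℝ, (∀ y : Fin n → ℝ, t * Real.exp (∑ i, (u i : ℝ) * y i) ≤ expEval y P) →
      IsAGE u (P - Finsupp.single u t) := fun t ht =>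
    ⟨fun j hj => by simp [hj.symm, hP], fun y => by
      rw [map_sub, expEval_single, sub_nonneg]; exact ht y⟩
  by_cases hu : IsEvenRatPt u
  · convert (hkey r he).isSAGE
    ext q
    by_cases hq : IsEvenRatPt q
    · rw [signed_apply_of_even _ hq]
    · rw [signed_apply_of_not_even _ hq]
      have : u ≠ q := fun h => hq (h ▸ hu)
      simp [hPe q hq, this]
  · convert (hkey |r| fun y => ?_).isSAGE
    · ext q
      by_cases hq : IsEvenRatPt q
      · rw [signed_apply_of_even _ hq]
        have : u ≠ q := fun h => hu (h ▸ hq)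
        simp [this]
      · rw [signed_apply_of_not_even _ hq]
        by_cases huq : u = q <;> simp [hPe q hq, huq]
    · rcases abs_choice r with h | h
      · rw [h]; exact he y
      · rw [h]; exact ho hu y

theorem mem_posPart {f : MvPolynomial (Fin n) ℝ} {α : Fin n →₀ ℕ} :
    α ∈ posPart f ↔ IsEvenPt α ∧ 0 < f.coeff α := by
  simp only [posPart, Finset.mem_filter, MvPolynomial.mem_support_iff]
  exact ⟨fun h => h.2, fun h => ⟨h.2.ne', h⟩⟩

theorem mem_negPart {f : MvPolynomial (Fin n) ℝ} {β : Fin n →₀ ℕ} :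
    β ∈ negPart f ↔ f.coeff β ≠ 0 ∧ (IsEvenPt β → f.coeff β < 0) := by
  simp only [negPart, Finset.mem_sdiff, mem_posPart, MvPolynomial.mem_support_iff, not_and, not_lt]
  exact ⟨fun h => ⟨h.1, fun he => lt_of_le_of_ne (h.2 he) h.1⟩, fun h => ⟨h.1, fun he => (h.2 he).le⟩⟩

theorem mem_circuits {f : MvPolynomial (Fin n) ℝ} {β : Fin n →₀ ℕ} {T : Finset (Fin n →₀ ℕ)} :
    T ∈ circuits f β ↔ T ⊆ posPart f ∧ IsCircuit T β := by
  simp [circuits]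

theorem signed_toRatPoly_of_mem_posPart {f : MvPolynomial (Fin n) ℝ} {α : Fin n →₀ ℕ}
    (hα : α ∈ posPart f) : signed (toRatPoly f).coeff (ratPt α) = f.coeff α := by
  rw [signed_apply_of_even _ (isEvenRatPt_ratPt.2 (mem_posPart.1 hα).1), coeff_toRatPoly]

theorem signed_toRatPoly_of_mem_negPart {f : MvPolynomial (Fin n) ℝ} {β : Fin n →₀ ℕ}
    (hβ : β ∈ negPart f) : signed (toRatPoly f).coeff (ratPt β) = -|f.coeff β| := by
  by_cases h : IsEvenPt β
  · rw [signed_apply_of_even _ (isEvenRatPt_ratPt.2 h), coeff_toRatPoly,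
      abs_of_neg ((mem_negPart.1 hβ).2 h), neg_neg]
  · rw [signed_apply_of_not_even _ (mt isEvenRatPt_ratPt.1 h), coeff_toRatPoly]

theorem signed_toRatPoly_of_notMem {f : MvPolynomial (Fin n) ℝ} {q : Fin n → ℚ}
    (hq : ∀ α ∈ f.support, ratPt α ≠ q) : signed (toRatPoly f).coeff q = 0 := by
  by_cases h : IsEvenRatPt q
  · rw [signed_apply_of_even _ h, coeff_toRatPoly_of_notMem f hq]
  · rw [signed_apply_of_not_even _ h, coeff_toRatPoly_of_notMem f hq, abs_zero, neg_zero]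

/-! ### Circuit decompositions from SAGE decompositions -/

/-- `f` splits into circuit polynomials supported on the circuits of `f`, up to monomial squares. -/
def HasCircuitDecomposition (f : MvPolynomial (Fin n) ℝ) : Prop :=
  ∃ (C : (Fin n →₀ ℕ) → Finset (Fin n →₀ ℕ) → (Fin n →₀ ℕ) → ℝ)
    (D : (Fin n →₀ ℕ) → Finset (Fin n →₀ ℕ) → ℝ),
    (∀ β ∈ negPart f, ∑ T ∈ circuits f β, D β T = |f.coeff β|) ∧
    (∀ α ∈ posPart f, ∑ β ∈ negPart f, ∑ T ∈ circuits f β, C β T α ≤ f.coeff α) ∧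
    ∀ β ∈ negPart f, ∀ T ∈ circuits f β, (∀ α, α ∉ T → C β T α = 0) ∧
      (((∀ α, C β T α = 0) ∧ D β T = 0) ∨ CircuitBound T β (C β T) (D β T))

theorem HasCircuitDecomposition.of_isSAGE {f : MvPolynomial (Fin n) ℝ}
    (hf : IsSAGE (signed (toRatPoly f).coeff)) : HasCircuitDecomposition f := by
  classical
  obtain ⟨S, g, hg, hS, hF, hsign⟩ := hf.exists_sign_preserving
  set F := signed (toRatPoly f).coeff with hFdef
  have hFS : ∀ q, F q = ∑ k ∈ S, g k q := fun q => by rw [hF, Finsupp.finsetSum_apply]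
  -- No cancellation: at another exponent of `Γ(f)` only the summand owned by that exponent may be
  -- nonzero, and off the support of `f` nonnegative values sum to zero.
  have hgneg : ∀ β ∈ negPart f, ∀ q, g (ratPt β) q ≠ 0 →
      q = ratPt β ∨ ∃ α ∈ posPart f, ratPt α = q := by
    intro β hβ q hq
    by_contra! hcon
    obtain ⟨h1, h2⟩ := hcon
    have hβS : ratPt β ∈ S := by
      by_contra h
      simp [hS _ h] at hq
    have hle : F q ≤ 0 := by
      by_cases h : ∃ γ ∈ f.support, ratPt γ = q
      · obtain ⟨γ, hγ, rfl⟩ := h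
        have : γ ∈ negPart f := Finset.mem_sdiff.2 ⟨hγ, fun h => h2 γ h rfl⟩
        rw [hFdef, signed_toRatPoly_of_mem_negPart this]
        exact neg_nonpos.2 (abs_nonneg _)
      · push Not at h
        exact (signed_toRatPoly_of_notMem h).le
    rcases hle.lt_or_eq with hlt | h0
    · exact hq ((hsign q).2 hlt _ h1.symm)
    · have hnn := (hsign q).1 h0.ge
      rw [hFS, Finset.sum_eq_zero_iff_of_nonneg fun k _ => hnn k] at h0
      exact hq (h0 _ hβS)
  have hgβ : ∀ β ∈ negPart f, g (ratPt β) (ratPt β) = -|f.coeff β| := by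
    intro β hβ
    have hval := signed_toRatPoly_of_mem_negPart hβ
    rw [← hFdef] at hval
    have hlt : F (ratPt β) < 0 := by
      rw [hval, neg_lt_zero]; exact abs_pos.2 (mem_negPart.1 hβ).1
    rw [← hval, hFS]
    refine (Finset.sum_eq_single (ratPt β) (fun k _ hk => (hsign _).2 hlt k hk) fun h => ?_).symm
    simp [hS _ h]
  have hpos : ∀ α ∈ posPart f, ∀ k, 0 ≤ g k (ratPt α) := fun α hα => by
    refine (hsign _).1 ?_
    rw [hFdef, signed_toRatPoly_of_mem_posPart hα]
    exact (mem_posPart.1 hα).2.le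
  have hdisj : ∀ β ∈ negPart f, ∀ α ∈ posPart f, ratPt β ≠ ratPt α := fun β hβ α hα h =>
    (Finset.mem_sdiff.1 hβ).2 (ratPt_injective h ▸ hα)
  have hexp : ∀ β ∈ negPart f, ∀ y : Fin n → ℝ,
      |f.coeff β| * Real.exp (∑ i, (β i : ℝ) * y i) ≤
        ∑ α ∈ posPart f, g (ratPt β) (ratPt α) * Real.exp (∑ i, (α i : ℝ) * y i) := by
    intro β hβ y
    have hrep : g (ratPt β) = ∑ α ∈ posPart f, Finsupp.single (ratPt α) (g (ratPt β) (ratPt α)) +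
        Finsupp.single (ratPt β) (-|f.coeff β|) := by
      ext q
      simp only [Finsupp.add_apply, Finsupp.finsetSum_apply, Finsupp.single_apply]
      by_cases h1 : q = ratPt β
      · subst h1
        rw [Finset.sum_eq_zero fun α hα => if_neg (hdisj β hβ α hα).symm, hgβ β hβ]
        simp
      · rw [if_neg (Ne.symm h1), add_zero]
        by_cases h2 : ∃ α ∈ posPart f, ratPt α = q
        · obtain ⟨α, hα, rfl⟩ := h2
          simp only [ratPt_injective.eq_iff, Finset.sum_ite_eq', hα, if_true]
        · by_cases h3 : g (ratPt β) q = 0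
          · rw [h3]
            refine (Finset.sum_eq_zero fun α hα => if_neg fun h => h2 ⟨α, hα, h⟩).symm
          · exact absurd (hgneg β hβ q h3) (not_or.2 ⟨h1, h2⟩)
    have h0 := (hg (ratPt β)).2 y
    rw [hrep, map_add, map_sum, expEval_single] at h0
    simp only [expEval_single, ratPt, Rat.cast_natCast] at h0
    linarith
  have hdec : ∀ β ∈ negPart f, _ := fun β hβ => exists_circuit_decomposition (posPart f)
    (fun α => g (ratPt β) (ratPt α)) (fun α hα => hpos α hα _) β
    (abs_pos.2 (mem_negPart.1 hβ).1) (hexp β hβ)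
  choose! C D hC hD hT using hdec
  have hcirc : ∀ β ∈ negPart f, ∀ T ∈ (posPart f).powerset, T ∉ circuits f β →
      (∀ α, C β T α = 0) ∧ D β T = 0 := by
    intro β hβ T hTp hTc
    rcases hT β hβ T hTp with h | ⟨h0, h1, -, wt, hw, hw1, hwb, -⟩
    · exact h
    · have hTp' := Finset.mem_powerset.1 hTp
      exact absurd (mem_circuits.2 ⟨hTp', ⟨⟨h0, fun α hα => (mem_posPart.1 (hTp' hα)).1, h1⟩,
        wt, hw, hw1, hwb⟩⟩) hTc
  have hsub : ∀ β, circuits f β ⊆ (posPart f).powerset := fun β T h =>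
    Finset.mem_powerset.2 (mem_circuits.1 h).1
  refine ⟨C, D, fun β hβ => ?_, fun α hα => ?_, fun β hβ T hTc => ?_⟩
  · rw [← hD β hβ]
    exact Finset.sum_subset (hsub β) fun T hTp hTc => (hcirc β hβ T hTp hTc).2
  -- The summands not owned by `Γ(f)` are nonnegative at `α`, so they may be discarded in this
  -- inequality.
  · calc ∑ β ∈ negPart f, ∑ T ∈ circuits f β, C β T α
        ≤ ∑ β ∈ negPart f, g (ratPt β) (ratPt α) := by
          refine Finset.sum_le_sum fun β hβ => ?_
          rw [Finset.sum_subset (hsub β) fun T hTp hTc => (hcirc β hβ T hTp hTc).1 α]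
          exact hC β hβ α hα
      _ = ∑ k ∈ (negPart f).image ratPt, g k (ratPt α) :=
          (Finset.sum_image (f := fun k => g k (ratPt α)) fun _ _ _ _ h => ratPt_injective h).symm
      _ ≤ ∑ k ∈ S ∪ (negPart f).image ratPt, g k (ratPt α) :=
          Finset.sum_le_sum_of_subset_of_nonneg Finset.subset_union_right
            fun k _ _ => hpos α hα k
      _ = ∑ k ∈ S, g k (ratPt α) :=
          (Finset.sum_subset Finset.subset_union_left fun k _ hk => by simp [hS k hk]).symm
      _ = f.coeff α := by rw [← hFS, hFdef, signed_toRatPoly_of_mem_posPart hα]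
  · rcases hT β hβ T (hsub β hTc) with h | ⟨-, -, h1, h2⟩
    · exact ⟨fun α _ => h.1 α, .inl h⟩
    · exact ⟨h1, .inr h2⟩

/-! ### SONC polynomials and the SAGE condition -/

theorem eval_monomial_eq_prod (x : Fin n → ℝ) (α : Fin n →₀ ℕ) (c : ℝ) :
    MvPolynomial.eval x (MvPolynomial.monomial α c) = c * ∏ i, x i ^ α i := by
  rw [MvPolynomial.eval_monomial, Finsupp.prod_fintype _ _ fun i => pow_zero _]

theorem prod_sign_mul_exp_pow (s y : Fin n → ℝ) (α : Fin n →₀ ℕ) :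
    ∏ i, (s i * Real.exp (y i)) ^ α i = (∏ i, s i ^ α i) * Real.exp (∑ i, (α i : ℝ) * y i) := by
  rw [Real.exp_sum, ← Finset.prod_mul_distrib]
  exact Finset.prod_congr rfl fun i _ => by rw [mul_pow, Real.exp_nat_mul]

theorem sum_ratPt_mul (α : Fin n →₀ ℕ) (y : Fin n → ℝ) :
    ∑ i, (ratPt α i : ℝ) * y i = ∑ i, (α i : ℝ) * y i := by simp [ratPt]

/-- Nonnegativity of a circuit polynomial on the orthant with signs `s`. -/
theorem exp_le_of_eval_nonneg {T : Finset (Fin n →₀ ℕ)} (hT : ∀ α ∈ T, IsEvenPt α)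
    {β : Fin n →₀ ℕ} {c : (Fin n →₀ ℕ) → ℝ} {d : ℝ}
    (hnn : ∀ x : Fin n → ℝ, 0 ≤ MvPolynomial.eval x
      (∑ α ∈ T, MvPolynomial.monomial α (c α) - MvPolynomial.monomial β d))
    (s : Fin n → ℝ) (hs : ∀ i, s i ^ 2 = 1) (y : Fin n → ℝ) :
    d * ((∏ i, s i ^ β i) * Real.exp (∑ i, (β i : ℝ) * y i)) ≤
      ∑ α ∈ T, c α * Real.exp (∑ i, (α i : ℝ) * y i) := by
  have h := hnn fun i => s i * Real.exp (y i)
  simp only [map_sub, map_sum, eval_monomial_eq_prod, prod_sign_mul_exp_pow] at h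
  rw [sub_nonneg] at h
  refine h.trans_eq (Finset.sum_congr rfl fun α hα => ?_)
  rw [Finset.prod_eq_one, one_mul]
  intro i _
  obtain ⟨k, hk⟩ := hT α hα i
  rw [hk, ← two_mul, pow_mul, hs, one_pow]

theorem IsNonnegCircuit.isSAGE_signed {g : MvPolynomial (Fin n) ℝ} (hg : IsNonnegCircuit g) :
    IsSAGE (signed (toRatPoly g).coeff) := by
  classical
  rcases hg with ⟨⟨T, β, c, d, hTβ, hc, rfl⟩, hnn⟩ | ⟨α, c, hα, hc, rfl⟩
  · have hcoef : (toRatPoly (∑ α ∈ T, MvPolynomial.monomial α (c α) -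
        MvPolynomial.monomial β d)).coeff =
        ∑ α ∈ T, Finsupp.single (ratPt α) (c α) - Finsupp.single (ratPt β) d := by
      have h1 : MvPolynomial.monomial β d = - MvPolynomial.monomial β (-d) := by simp
      rw [h1, sub_neg_eq_add, toRatPoly_add, toRatPoly_sum]
      simp only [toRatPoly_monomial, term, AddMonoidAlgebra.coeff_add, AddMonoidAlgebra.coeff_sum,
        AddMonoidAlgebra.coeff_single, Finsupp.single_neg, sub_eq_add_neg]
    have hexp : ∀ y : Fin n → ℝ, expEval y (∑ α ∈ T, Finsupp.single (ratPt α) (c α)) =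
        ∑ α ∈ T, c α * Real.exp (∑ i, (α i : ℝ) * y i) := fun y => by
      simp only [map_sum, expEval_single, sum_ratPt_mul]
    have hTe := hTβ.trellis.even
    rw [hcoef]
    refine IsSAGE.signed_sub_single (fun q => ?_) (fun q hq => ?_) _ _ (fun y => ?_)
      fun hβ y => ?_
    · rw [Finsupp.finsetSum_apply]
      refine Finset.sum_nonneg fun α hα => ?_
      rw [Finsupp.single_apply]
      split_ifs
      exacts [(hc α hα).le, le_rfl]
    · rw [Finsupp.finsetSum_apply]
      refine Finset.sum_eq_zero fun α hα => ?_
      rw [Finsupp.single_apply, if_neg]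
      rintro rfl
      exact hq (isEvenRatPt_ratPt.2 (hTe α hα))
    · rw [hexp, sum_ratPt_mul]
      simpa using exp_le_of_eval_nonneg hTe hnn (fun _ => 1) (by simp) y
    · rw [hexp, sum_ratPt_mul]
      rw [isEvenRatPt_ratPt, IsEvenPt] at hβ
      push Not at hβ
      obtain ⟨i₀, hi₀⟩ := hβ
      -- Reflecting one coordinate in which `β` is odd changes the sign of `x^β` and fixes the even
      -- monomials.
      have h := exp_le_of_eval_nonneg hTe hnn (fun i => if i = i₀ then -1 else 1)
        (fun i => by split_ifs <;> norm_num) y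
      have hprod : ∏ i, (if i = i₀ then (-1 : ℝ) else 1) ^ β i = -1 := by
        rw [Finset.prod_eq_single i₀ (fun i _ hi => by simp [hi]) (by simp), if_pos rfl]
        exact Odd.neg_one_pow (Nat.not_even_iff_odd.1 hi₀)
      rw [hprod] at h
      linarith
  · rw [toRatPoly_monomial]
    refine .of_nonneg fun q => ?_
    by_cases hq : IsEvenRatPt q
    · rw [signed_apply_of_even _ hq]
      simp only [term, AddMonoidAlgebra.coeff_single, Finsupp.single_apply]
      split_ifs
      exacts [hc, le_rfl]
    · rw [signed_apply_of_not_even _ hq]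
      have : ratPt α ≠ q := fun h => hq (h ▸ isEvenRatPt_ratPt.2 hα)
      simp [term, this]

theorem IsSONC.isSAGE_signed {f : MvPolynomial (Fin n) ℝ} (hf : IsSONC f) :
    IsSAGE (signed (toRatPoly f).coeff) := by
  obtain ⟨m, g, hg, rfl⟩ := hf
  rw [toRatPoly_sum, AddMonoidAlgebra.coeff_sum]
  exact IsSAGE.signed_sum _ fun k _ => (hg k).isSAGE_signed

theorem isSONC_zero : IsSONC (0 : MvPolynomial (Fin n) ℝ) :=
  ⟨0, fun _ => 0, fun k => k.elim0, by simp⟩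

theorem IsNonnegCircuit.isSONC {g : MvPolynomial (Fin n) ℝ} (hg : IsNonnegCircuit g) : IsSONC g :=
  ⟨1, fun _ => g, fun _ => hg, by simp⟩

theorem IsSONC.add {f g : MvPolynomial (Fin n) ℝ} (hf : IsSONC f) (hg : IsSONC g) :
    IsSONC (f + g) := by
  obtain ⟨m, F, hF, rfl⟩ := hf
  obtain ⟨k, G, hG, rfl⟩ := hg
  refine ⟨m + k, Fin.append F G, fun i => ?_, by simp [Fin.sum_univ_add]⟩
  induction i using Fin.addCases with
  | left i => simpa using hF i
  | right i => simpa using hG i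

theorem IsSONC.sum {ι : Type*} (s : Finset ι) {g : ι → MvPolynomial (Fin n) ℝ}
    (h : ∀ i ∈ s, IsSONC (g i)) : IsSONC (∑ i ∈ s, g i) :=
  Finset.sum_induction g IsSONC (fun _ _ => IsSONC.add) isSONC_zero h

/-! ### From circuit decompositions to SONC -/

/-- The weighted arithmetic-geometric mean inequality for circuit polynomials. -/
theorem CircuitBound.le_sum {T : Finset (Fin n →₀ ℕ)} {β : Fin n →₀ ℕ}
    {C : (Fin n →₀ ℕ) → ℝ} {D : ℝ} (h : CircuitBound T β C D) (x : Fin n → ℝ)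
    (hx : ∀ i, 0 ≤ x i) : D * ∏ i, x i ^ β i ≤ ∑ α ∈ T, C α * ∏ i, x i ^ α i := by
  obtain ⟨wt, hwt, hwt1, hwtb, hC, -, hD⟩ := h
  have hpow : ∀ α : Fin n →₀ ℕ, 0 ≤ ∏ i, x i ^ α i :=
    fun α => Finset.prod_nonneg fun i _ => pow_nonneg (hx i) _
  have hCw : ∀ α ∈ T, 0 < C α / wt α := fun α hα => div_pos (hC α hα) (hwt α hα)
  have hβ : ∏ i, x i ^ β i = ∏ α ∈ T, (∏ i, x i ^ α i) ^ wt α := by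
    simp only [← Real.finsetProd_rpow _ _ fun i _ => pow_nonneg (hx i) _]
    rw [Finset.prod_comm]
    refine Finset.prod_congr rfl fun i _ => ?_
    have hi : (β i : ℝ) = ∑ α ∈ T, wt α * (α i : ℝ) := by
      have := congrFun hwtb i
      simpa [realPt, Finset.sum_apply] using this
    rw [← Real.rpow_natCast, hi, Real.rpow_sum_of_nonneg (hx i)
      fun α hα => mul_nonneg (hwt α hα).le (Nat.cast_nonneg _)]
    exact Finset.prod_congr rfl fun α _ => by
      rw [mul_comm, Real.rpow_mul (hx i), Real.rpow_natCast]
  have hΘ : Real.exp (∑ α ∈ T, wt α * Real.log (C α / wt α)) = ∏ α ∈ T, (C α / wt α) ^ wt α := by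
    rw [Real.exp_sum]
    exact Finset.prod_congr rfl fun α hα => by rw [Real.rpow_def_of_pos (hCw α hα), mul_comm]
  calc D * ∏ i, x i ^ β i
      ≤ (∏ α ∈ T, (C α / wt α) ^ wt α) * ∏ i, x i ^ β i := by
        rw [← hΘ]; exact mul_le_mul_of_nonneg_right hD (hpow β)
    _ = ∏ α ∈ T, (C α / wt α * ∏ i, x i ^ α i) ^ wt α := by
        rw [hβ, ← Finset.prod_mul_distrib]
        exact Finset.prod_congr rfl fun α hα => (Real.mul_rpow (hCw α hα).le (hpow α)).symm
    _ ≤ ∑ α ∈ T, wt α * (C α / wt α * ∏ i, x i ^ α i) :=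
        Real.geom_mean_le_arith_mean_weighted T wt _ (fun α hα => (hwt α hα).le) hwt1
          fun α hα => mul_nonneg (hCw α hα).le (hpow α)
    _ = ∑ α ∈ T, C α * ∏ i, x i ^ α i := by
        refine Finset.sum_congr rfl fun α hα => ?_
        rw [← mul_assoc, mul_div_cancel₀ _ (hwt α hα).ne']

theorem CircuitBound.isNonnegCircuit {T : Finset (Fin n →₀ ℕ)} {β : Fin n →₀ ℕ}
    {C : (Fin n →₀ ℕ) → ℝ} {D d : ℝ} (h : CircuitBound T β C D) (hT : IsCircuit T β)
    (hd : |d| ≤ D) :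
    IsNonnegCircuit (∑ α ∈ T, MvPolynomial.monomial α (C α) - MvPolynomial.monomial β d) := by
  refine Or.inl ⟨⟨T, β, C, d, hT, ?_, rfl⟩, fun x => ?_⟩
  · obtain ⟨-, -, -, -, hC, -⟩ := h
    exact hC
  · simp only [map_sub, map_sum, eval_monomial_eq_prod]
    rw [sub_nonneg]
    have h1 : ∀ α : Fin n →₀ ℕ, ∏ i, |x i| ^ α i = |∏ i, x i ^ α i| := fun α => by
      rw [Finset.abs_prod]
      exact Finset.prod_congr rfl fun i _ => (abs_pow _ _).symm
    have h2 := h.le_sum (fun i => |x i|) fun i => abs_nonneg _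
    calc d * ∏ i, x i ^ β i ≤ |d * ∏ i, x i ^ β i| := le_abs_self _
      _ = |d| * ∏ i, |x i| ^ β i := by rw [abs_mul, h1]
      _ ≤ D * ∏ i, |x i| ^ β i := by
          rw [h1]; exact mul_le_mul_of_nonneg_right hd (abs_nonneg _)
      _ ≤ _ := h2
      _ = _ := by
          refine Finset.sum_congr rfl fun α hα => ?_
          rw [h1, abs_of_nonneg]
          exact Finset.prod_nonneg fun i _ => (hT.trellis.even α hα i).pow_nonneg _

/-- The polynomial identity expressed by a circuit decomposition, for coefficientwise maps into an
abelian group. -/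
theorem sum_circuits_add_remainder {M : Type*} [AddCommGroup M] {f : MvPolynomial (Fin n) ℝ}
    {C : (Fin n →₀ ℕ) → Finset (Fin n →₀ ℕ) → (Fin n →₀ ℕ) → ℝ}
    {D : (Fin n →₀ ℕ) → Finset (Fin n →₀ ℕ) → ℝ}
    (hD : ∀ β ∈ negPart f, ∑ T ∈ circuits f β, D β T = |f.coeff β|)
    (hC0 : ∀ β ∈ negPart f, ∀ T ∈ circuits f β, ∀ α, α ∉ T → C β T α = 0)
    (φ : (Fin n →₀ ℕ) → ℝ →+ M) :
    ∑ α ∈ f.support, φ α (f.coeff α) =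
      ∑ β ∈ negPart f, ∑ T ∈ circuits f β,
        (∑ α ∈ T, φ α (C β T α) - φ β (-SignType.sign (f.coeff β) * D β T)) +
      ∑ α ∈ posPart f, φ α (f.coeff α - ∑ β ∈ negPart f, ∑ T ∈ circuits f β, C β T α) := by
  have hsub : posPart f ⊆ f.support := by classical exact Finset.filter_subset _ _
  have h1 : ∀ β ∈ negPart f, ∑ T ∈ circuits f β,
      (∑ α ∈ T, φ α (C β T α) - φ β (-SignType.sign (f.coeff β) * D β T)) =
      ∑ α ∈ posPart f, φ α (∑ T ∈ circuits f β, C β T α) + φ β (f.coeff β) := by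
    intro β hβ
    rw [Finset.sum_sub_distrib, ← map_sum, ← Finset.mul_sum, hD β hβ, neg_mul, sign_mul_abs,
      map_neg, sub_neg_eq_add]
    congr 1
    simp only [map_sum]
    rw [Finset.sum_comm]
    refine Finset.sum_congr rfl fun T hT => ?_
    exact Finset.sum_subset (mem_circuits.1 hT).1 fun α _ hα => by rw [hC0 β hβ T hT α hα, map_zero]
  rw [Finset.sum_congr rfl h1, Finset.sum_add_distrib, Finset.sum_comm]
  simp only [map_sub, Finset.sum_sub_distrib, ← map_sum]
  rw [negPart, ← Finset.sum_sdiff hsub]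
  abel

theorem HasCircuitDecomposition.isSONC {f : MvPolynomial (Fin n) ℝ}
    (hf : HasCircuitDecomposition f) : IsSONC f := by
  obtain ⟨C, D, hD, hC, h⟩ := hf
  have hrep := sum_circuits_add_remainder hD (fun β hβ T hT => (h β hβ T hT).1)
    fun α => (MvPolynomial.monomial (R := ℝ) α).toAddMonoidHom
  simp only [LinearMap.toAddMonoidHom_coe] at hrep
  rw [f.as_sum, hrep]
  refine .add (.sum _ fun β hβ => .sum _ fun T hT => ?_) (.sum _ fun α hα => ?_)
  · rcases (h β hβ T hT).2 with ⟨h1, h2⟩ | hb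
    · simpa [h1, h2] using isSONC_zero
    · refine (hb.isNonnegCircuit (mem_circuits.1 hT).2 ?_).isSONC
      obtain ⟨-, -, -, -, -, hD0, -⟩ := hb
      rw [abs_mul, abs_neg, abs_of_nonneg hD0]
      refine mul_le_of_le_one_left hD0 ?_
      rcases SignType.trichotomy (SignType.sign (f.coeff β)) with hs | hs | hs <;> simp [hs]
  · exact IsNonnegCircuit.isSONC
      (.inr ⟨α, _, (mem_posPart.1 hα).1, sub_nonneg.2 (hC α hα), rfl⟩)

/-! ### Binomial squares and the SAGE condition -/

theorem binomial_sq {u v w : Fin n → ℚ} (hu : u = (1 / 2 : ℚ) • (v + w)) (a b : ℝ) :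
    ((term ((1 / 2 : ℚ) • v) a - term ((1 / 2 : ℚ) • w) b) ^ 2 : RatPoly n) =
      term v (a ^ 2) + term w (b ^ 2) - term u (2 * a * b) := by
  have h2 : ∀ x : Fin n → ℚ, (1 / 2 : ℚ) • x + (1 / 2 : ℚ) • x = x := fun x => by
    rw [← add_smul]; norm_num
  rw [sub_sq, mul_assoc]
  simp only [term, sq, AddMonoidAlgebra.single_mul_single, h2]
  rw [← smul_add, ← hu, two_mul, ← AddMonoidAlgebra.single_add,
    show a * b + a * b = 2 * a * b by ring]
  abel

/-- A square of a binomial along a midpoint is a SAGE signomial after sign normalization. -/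
theorem isSAGE_signed_binomial_sq {u v w : Fin n → ℚ} (hv : IsEvenRatPt v) (hw : IsEvenRatPt w)
    (hu : u = (1 / 2 : ℚ) • (v + w)) (a b : ℝ) :
    IsSAGE (signed ((term ((1 / 2 : ℚ) • v) a - term ((1 / 2 : ℚ) • w) b) ^ 2 : RatPoly n).coeff) := by
  classical
  rw [binomial_sq hu]
  simp only [term, AddMonoidAlgebra.coeff_sub, AddMonoidAlgebra.coeff_add,
    AddMonoidAlgebra.coeff_single]
  have key : ∀ (t : ℝ), |t| ≤ |2 * a * b| → ∀ y : Fin n → ℝ,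
      t * Real.exp (∑ i, (u i : ℝ) * y i) ≤
        expEval y (Finsupp.single v (a ^ 2) + Finsupp.single w (b ^ 2)) := by
    intro t ht y
    rw [map_add, expEval_single, expEval_single]
    set X := Real.exp ((∑ i, (v i : ℝ) * y i) / 2) with hX
    set Y := Real.exp ((∑ i, (w i : ℝ) * y i) / 2) with hY
    have hX2 : Real.exp (∑ i, (v i : ℝ) * y i) = X ^ 2 := by
      rw [hX, sq, ← Real.exp_add, add_halves]
    have hY2 : Real.exp (∑ i, (w i : ℝ) * y i) = Y ^ 2 := by
      rw [hY, sq, ← Real.exp_add, add_halves]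
    have hXY : Real.exp (∑ i, (u i : ℝ) * y i) = X * Y := by
      rw [hX, hY, ← Real.exp_add, ← add_div, ← Finset.sum_add_distrib, Finset.sum_div, hu]
      congr 1
      refine Finset.sum_congr rfl fun i _ => ?_
      simp only [Pi.smul_apply, Pi.add_apply, smul_eq_mul]
      push_cast
      ring
    rw [hX2, hY2, hXY]
    have hXYpos : 0 < X * Y := mul_pos (Real.exp_pos _) (Real.exp_pos _)
    calc t * (X * Y) ≤ |2 * a * b| * (X * Y) :=
          mul_le_mul_of_nonneg_right ((le_abs_self t).trans ht) hXYpos.le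
      _ = 2 * (|a| * X) * (|b| * Y) := by
          rw [abs_mul, abs_mul, abs_two]; ring
      _ ≤ (|a| * X) ^ 2 + (|b| * Y) ^ 2 := two_mul_le_add_sq _ _
      _ = _ := by rw [mul_pow, mul_pow, sq_abs, sq_abs]
  refine IsSAGE.signed_sub_single (fun q => ?_) (fun q hq => ?_) _ _ (key _ le_rfl)
    fun _ => key _ (abs_neg _).le
  · simp only [Finsupp.add_apply, Finsupp.single_apply]
    split_ifs <;> positivity
  · have h1 : v ≠ q := fun h => hq (h ▸ hv)
    have h2 : w ≠ q := fun h => hq (h ▸ hw)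
    simp [h1, h2]

/-- Only `β` may fail to be even. If `β` is itself an endpoint `v`, then `v = 2u - w`, where `u` and
`w` differ from `β` and are therefore even; so `β` is even in that case. -/
theorem IsOddMediatedSet.isEvenRatPt {T : Finset (Fin n →₀ ℕ)} {β : Fin n →₀ ℕ}
    {M : Finset (Fin n → ℚ)} (hM : IsOddMediatedSet T β M) {u v w : Fin n → ℚ} (hu : u ∈ M)
    (hv : v ∈ M) (hw : w ∈ M) (hvw : v ≠ w) (huvw : u = (1 / 2 : ℚ) • (v + w)) :
    IsEvenRatPt v := by
  have heven : ∀ q ∈ M, q ≠ ratPt β → IsEvenRatPt q := fun q hq hqβ i =>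
    ⟨hM.odd_den q hq i, hM.even_num q hq hqβ i⟩
  have hv2 : v = (2 : ℚ) • u - w := by
    rw [huvw, smul_smul]; norm_num
  by_cases hvβ : v = ratPt β
  · rw [hv2]
    refine (heven u hu fun h => hvw ?_).two_smul_sub (heven w hw fun h => hvw (hvβ.trans h.symm))
    rw [h, ← hvβ] at hv2
    rw [eq_sub_iff_add_eq, two_smul] at hv2
    exact (add_left_cancel hv2).symm
  · exact heven v hv hvβ

theorem isSAGE_signed_term {q : Fin n → ℚ} (hq : IsEvenRatPt q) {c : ℝ} (hc : 0 ≤ c) :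
    IsSAGE (signed (term q c).coeff) := by
  classical
  simpa [term] using IsSAGE.signed_sub_single (P := Finsupp.single q c)
    (fun x => by rw [Finsupp.single_apply]; split_ifs; exacts [hc, le_rfl])
    (fun x hx => by
      have : q ≠ x := fun h => hx (h ▸ hq)
      simp [this]) q 0
    (fun y => by rw [expEval_single, zero_mul]; exact mul_nonneg hc (Real.exp_pos _).le)
    fun h => absurd hq h

/-! ### The random walk on a mediated set -/

/-- Existence of the Green function of the random walk `u ↦ v u, w u` on `S` started at `b`, given
a superharmonic function `g` that drops by at least one at each step. -/
theorem exists_green {V : Type*} [DecidableEq V] (S M : Finset V) (v w : V → V) (g : V → ℝ)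
    (hSM : S ⊆ M) (hg : ∀ x ∈ M, 0 ≤ g x) (hv : ∀ u ∈ S, v u ∈ M) (hw : ∀ u ∈ S, w u ∈ M)
    (hgs : ∀ u ∈ S, 1 + 1 / 2 * (g (v u) + g (w u)) ≤ g u) {b : V} (hb : b ∈ S) :
    ∃ y : V → ℝ, (∀ x, 0 ≤ y x) ∧ ∀ x ∈ S, y x = (if x = b then 1 else 0) +
      1 / 2 * ∑ u ∈ S, y u * ((if v u = x then 1 else 0) + (if w u = x then 1 else 0)) := by
  set A : (V → ℝ) → V → ℝ := fun y x => (if x = b then 1 else 0) +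
      1 / 2 * ∑ u ∈ S, y u * ((if v u = x then 1 else 0) + (if w u = x then 1 else 0)) with hA
  have hind : ∀ a x : V, (0 : ℝ) ≤ if a = x then 1 else 0 := fun a x => by
    split_ifs <;> norm_num
  have hmono : ∀ y z : V → ℝ, (∀ x, y x ≤ z x) → ∀ x, A y x ≤ A z x := fun y z h x => by
    refine add_le_add le_rfl (mul_le_mul_of_nonneg_left (Finset.sum_le_sum fun u _ => ?_)
      (by norm_num))
    exact mul_le_mul_of_nonneg_right (h u) (add_nonneg (hind _ _) (hind _ _))
  -- On `S`, `Y k x` is the expected number of visits to `x` among the first `k` positions. It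
  -- increases with `k`, and its limit is the required fixed point once it is bounded.
  set Y : ℕ → V → ℝ := fun k => A^[k] 0 with hY
  have hYs : ∀ k, Y (k + 1) = A (Y k) := fun k => Function.iterate_succ_apply' A k 0
  have hstep : ∀ k x, Y k x ≤ Y (k + 1) x := by
    intro k
    induction k with
    | zero =>
      intro x
      rw [hYs]
      simp only [hY, hA, Function.iterate_zero, id, Pi.zero_apply, zero_mul, Finset.sum_const_zero,
        mul_zero, add_zero]
      exact hind _ _
    | succ k ih =>
      intro x
      rw [hYs, hYs (k + 1)]
      exact hmono _ _ ih x
  have hYm : ∀ x, Monotone fun k => Y k x := fun x => monotone_nat_of_le_succ fun k => hstep k x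
  have hY0 : ∀ k x, 0 ≤ Y k x := fun k x => hYm x (Nat.zero_le k)
  -- The potential `g` starts at `g b`, stays nonnegative and loses at least 1 in expectation at
  -- each step taken from `S`.
  have hbound : ∀ k, ∑ x ∈ S, Y k x ≤ g b := by
    intro k
    have hpt : ∀ z ∈ M, ∑ x ∈ S, (if z = x then (1 : ℝ) else 0) * g x ≤ g z := fun z hz => by
      simp only [ite_mul, one_mul, zero_mul, Finset.sum_ite_eq]
      split_ifs
      exacts [le_rfl, hg z hz]
    have h1 : ∑ x ∈ S, Y (k + 1) x * g x ≤
        g b + 1 / 2 * ∑ u ∈ S, Y k u * (g (v u) + g (w u)) := by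
      have : ∀ x ∈ S, Y (k + 1) x * g x = (if x = b then 1 else 0) * g x + 1 / 2 *
          ∑ u ∈ S, Y k u * ((if v u = x then 1 else 0) * g x + (if w u = x then 1 else 0) * g x) := by
        intro x _
        rw [hYs, hA]
        simp only [add_mul, mul_assoc, Finset.sum_mul]
      rw [Finset.sum_congr rfl this, Finset.sum_add_distrib, ← Finset.mul_sum, Finset.sum_comm]
      refine add_le_add (le_of_eq ?_) (mul_le_mul_of_nonneg_left
        (Finset.sum_le_sum fun u hu => ?_) (by norm_num))
      · simp [hb]
      · rw [← Finset.mul_sum, Finset.sum_add_distrib]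
        exact mul_le_mul_of_nonneg_left (add_le_add (hpt _ (hv u hu)) (hpt _ (hw u hu))) (hY0 k u)
    have h2 : ∑ x ∈ S, Y k x * g x ≤ ∑ x ∈ S, Y (k + 1) x * g x :=
      Finset.sum_le_sum fun x hx => mul_le_mul_of_nonneg_right (hstep k x) (hg x (hSM hx))
    have h3 : ∑ x ∈ S, Y k x + 1 / 2 * ∑ u ∈ S, Y k u * (g (v u) + g (w u)) ≤
        ∑ x ∈ S, Y k x * g x := by
      rw [Finset.mul_sum, ← Finset.sum_add_distrib]
      refine Finset.sum_le_sum fun u hu => ?_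
      have := mul_le_mul_of_nonneg_left (hgs u hu) (hY0 k u)
      linarith
    linarith
  have hbdd : ∀ x ∈ S, BddAbove (Set.range fun k => Y k x) := fun x hx => by
    refine ⟨g b, ?_⟩
    rintro _ ⟨k, rfl⟩
    exact (Finset.single_le_sum (f := Y k) (fun x _ => hY0 k x) hx).trans (hbound k)
  have hlim : ∀ x ∈ S, Filter.Tendsto (fun k => Y k x) Filter.atTop (nhds (⨆ k, Y k x)) :=
    fun x hx => tendsto_atTop_ciSup (hYm x) (hbdd x hx)
  refine ⟨fun x => ⨆ k, Y k x, fun x => Real.iSup_nonneg fun k => hY0 k x, fun x hx => ?_⟩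
  refine tendsto_nhds_unique ((Filter.tendsto_add_atTop_iff_nat 1).2 (hlim x hx)) ?_
  simp only [hYs, hA]
  exact tendsto_const_nhds.add ((tendsto_finsetSum _ fun u hu =>
    (hlim u hu).mul_const _).const_mul _)

/-- Summation by parts: collected by endpoint, the averages give each `x` its expected number of
arrivals. On `S` this is `y x`, less 1 at the starting point `b`, so only the exit terms and `φ b`
survive. -/
theorem green_sum {V E : Type*} [DecidableEq V] [AddCommGroup E] [Module ℝ E] {S M : Finset V}
    {v w : V → V} (hSM : S ⊆ M) (hv : ∀ u ∈ S, v u ∈ M) (hw : ∀ u ∈ S, w u ∈ M) {b : V}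
    (hb : b ∈ S) {y : V → ℝ} (hy : ∀ x ∈ S, y x = (if x = b then 1 else 0) +
      1 / 2 * ∑ u ∈ S, y u * ((if v u = x then 1 else 0) + (if w u = x then 1 else 0)))
    (φ : V → E) :
    ∑ u ∈ S, y u • ((1 / 2 : ℝ) • φ (v u) + (1 / 2 : ℝ) • φ (w u) - φ u) =
      ∑ x ∈ M \ S, (1 / 2 * ∑ u ∈ S, y u *
        ((if v u = x then 1 else 0) + (if w u = x then 1 else 0))) • φ x - φ b := by
  set τ : V → ℝ := fun x => 1 / 2 * ∑ u ∈ S, y u *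
        ((if v u = x then 1 else 0) + (if w u = x then 1 else 0)) with hτ
  have hpt : ∀ z ∈ M, φ z = ∑ x ∈ M, (if z = x then (1 : ℝ) else 0) • φ x := fun z hz => by
    simp [hz]
  have h1 : ∑ u ∈ S, y u • ((1 / 2 : ℝ) • φ (v u) + (1 / 2 : ℝ) • φ (w u)) =
      ∑ x ∈ M, τ x • φ x := by
    simp only [hτ, Finset.mul_sum, Finset.sum_smul]
    rw [Finset.sum_comm]
    refine Finset.sum_congr rfl fun u hu => ?_
    rw [hpt _ (hv u hu), hpt _ (hw u hu), Finset.smul_sum, Finset.smul_sum,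
      ← Finset.sum_add_distrib, Finset.smul_sum]
    refine Finset.sum_congr rfl fun x _ => ?_
    rw [smul_smul, smul_smul, ← add_smul, smul_smul]
    congr 1
    ring
  have h2 : ∑ x ∈ S, τ x • φ x = ∑ x ∈ S, y x • φ x - φ b := by
    have : ∀ x ∈ S, τ x • φ x = y x • φ x - (if x = b then (1 : ℝ) else 0) • φ x := fun x hx => by
      rw [← sub_smul]
      congr 1
      rw [hy x hx]
      ring
    rw [Finset.sum_congr rfl this, Finset.sum_sub_distrib]
    simp [hb]
  simp only [smul_sub, Finset.sum_sub_distrib] at h1 ⊢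
  rw [h1, ← Finset.sum_sdiff hSM, h2]
  abel

/-- A function that drops by at least one along each averaging step. -/
theorem exists_strict_superharmonic (S M : Finset (Fin n → ℚ))
    (v w : (Fin n → ℚ) → Fin n → ℚ)
    (h : ∀ u ∈ S, v u ≠ w u ∧ u = (1 / 2 : ℚ) • (v u + w u)) :
    ∃ g : (Fin n → ℚ) → ℝ, (∀ x ∈ M, 0 ≤ g x) ∧
      ∀ u ∈ S, 1 + 1 / 2 * (g (v u) + g (w u)) ≤ g u := by
  set ψ : (Fin n → ℚ) → ℝ := fun x => ∑ i, (x i : ℝ) ^ 2 with hψ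
  have hψ0 : ∀ x, 0 ≤ ψ x := fun x => Finset.sum_nonneg fun i _ => sq_nonneg _
  have hpar : ∀ u ∈ S, 1 / 2 * (ψ (v u) + ψ (w u)) - ψ u = ψ (v u - w u) / 4 := fun u hu => by
    simp only [hψ]
    rw [← Finset.sum_add_distrib, Finset.mul_sum, ← Finset.sum_sub_distrib, Finset.sum_div]
    refine Finset.sum_congr rfl fun i _ => ?_
    have : (u i : ℝ) = 1 / 2 * ((v u i : ℝ) + w u i) := by
      have := congrFun (h u hu).2 i
      simp only [Pi.smul_apply, Pi.add_apply, smul_eq_mul] at this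
      rw [this]
      push_cast
      ring
    rw [this, Pi.sub_apply]
    push_cast
    ring
  have hpos : ∀ u ∈ S, 0 < ψ (v u - w u) := fun u hu => by
    obtain ⟨i, hi⟩ := Function.ne_iff.1 (sub_ne_zero.2 (h u hu).1)
    refine Finset.sum_pos' (fun i _ => sq_nonneg _) ⟨i, Finset.mem_univ i, ?_⟩
    have : (((v u - w u) i : ℚ) : ℝ) ≠ 0 := by exact_mod_cast hi
    positivity
  -- By the parallelogram law, averaging over `v u`, `w u` raises `ψ` by `ψ (v u - w u) / 4 > 0`.
  -- The factor `A` turns every such gap into at least 1, and `∑ z ∈ M, ψ z` bounds `ψ` on `M`, so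
  -- the reversed function is nonnegative there.
  set A := ∑ u ∈ S, 4 / ψ (v u - w u) with hA
  have hA0 : 0 ≤ A := Finset.sum_nonneg fun u hu => (div_pos (by norm_num) (hpos u hu)).le
  refine ⟨fun x => A * (∑ z ∈ M, ψ z - ψ x), fun x hx => mul_nonneg hA0 (sub_nonneg.2
    (Finset.single_le_sum (fun z _ => hψ0 z) hx)), fun u hu => ?_⟩
  have h1 : 4 / ψ (v u - w u) ≤ A := Finset.single_le_sum (f := fun u => 4 / ψ (v u - w u))
    (fun u hu => (div_pos (by norm_num) (hpos u hu)).le) hu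
  have h2 : 1 ≤ A * (ψ (v u - w u) / 4) := by
    have := mul_le_mul_of_nonneg_right h1 (div_pos (hpos u hu) (by norm_num : (0 : ℝ) < 4)).le
    rwa [div_mul_div_cancel₀ (hpos u hu).ne', div_self (by norm_num)] at this
  rw [← hpar u hu] at h2
  linarith

theorem ratPt_cast (α : Fin n →₀ ℕ) : (fun i => (ratPt α i : ℝ)) = realPt α := by
  funext i; simp [ratPt, realPt]

theorem eq_of_barycentric {T : Finset (Fin n →₀ ℕ)}
    (hT : AffineIndependent ℝ (fun α : T => realPt (α : Fin n →₀ ℕ)))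
    {s t : (Fin n →₀ ℕ) → ℝ} (h1 : ∑ α ∈ T, s α = ∑ α ∈ T, t α)
    (h2 : ∑ α ∈ T, s α • realPt α = ∑ α ∈ T, t α • realPt α) : ∀ α ∈ T, s α = t α := by
  intro α hα
  have := affineIndependent_iff.1 hT Finset.univ (fun a => s a - t a)
    (by
      rw [Finset.sum_sub_distrib, Finset.sum_coe_sort T s, Finset.sum_coe_sort T t, h1, sub_self])
    (by
      simp only [sub_smul, Finset.sum_sub_distrib]
      rw [Finset.sum_coe_sort T fun a => s a • realPt a,
        Finset.sum_coe_sort T fun a => t a • realPt a, h2, sub_self])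
    ⟨α, hα⟩ (Finset.mem_univ _)
  exact sub_eq_zero.1 this

/-- The summation formula with `φ = 1` and with `φ` the inclusion shows that the exit law has mass 1
and barycentre `β`; affine independence identifies it with `wt`. The bound `1 ≤ y (ratPt β)` counts
the initial visit. -/
theorem exists_green_of_mediated {T : Finset (Fin n →₀ ℕ)} {β : Fin n →₀ ℕ}
    {M : Finset (Fin n → ℚ)} {v w : (Fin n → ℚ) → Fin n → ℚ}
    (hT : AffineIndependent ℝ (fun α : T => realPt (α : Fin n →₀ ℕ))) (hβT : β ∉ T)
    (hTM : T.image ratPt ⊆ M) (hβM : ratPt β ∈ M)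
    (h : ∀ u ∈ M \ T.image ratPt, v u ∈ M ∧ w u ∈ M ∧ v u ≠ w u ∧ u = (1 / 2 : ℚ) • (v u + w u))
    {wt : (Fin n →₀ ℕ) → ℝ} (hwt1 : ∑ α ∈ T, wt α = 1)
    (hwtb : realPt β = ∑ α ∈ T, wt α • realPt α) :
    ∃ y : (Fin n → ℚ) → ℝ, (∀ u, 0 ≤ y u) ∧ 1 ≤ y (ratPt β) ∧
      (∀ α ∈ T, wt α = 1 / 2 * ∑ u ∈ M \ T.image ratPt, y u *
        ((if v u = ratPt α then 1 else 0) + (if w u = ratPt α then 1 else 0))) ∧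
      ∀ φ : (Fin n → ℚ) → RatPoly n,
        ∑ u ∈ M \ T.image ratPt,
          y u • ((1 / 2 : ℝ) • φ (v u) + (1 / 2 : ℝ) • φ (w u) - φ u) =
        ∑ α ∈ T, wt α • φ (ratPt α) - φ (ratPt β) := by
  set S := M \ T.image ratPt with hS
  have hSM : S ⊆ M := Finset.sdiff_subset
  have hβS : ratPt β ∈ S := by
    refine Finset.mem_sdiff.2 ⟨hβM, fun hmem => ?_⟩
    obtain ⟨α, hα, hαβ⟩ := Finset.mem_image.1 hmem
    exact hβT (ratPt_injective hαβ ▸ hα)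
  have hv := fun u hu => (h u hu).1
  have hw := fun u hu => (h u hu).2.1
  obtain ⟨g, hg, hgs⟩ := exists_strict_superharmonic S M v w fun u hu => (h u hu).2.2
  obtain ⟨y, hy0, hy⟩ := exists_green S M v w g hSM hg hv hw hgs hβS
  have hMS : M \ S = T.image ratPt := by rw [hS, Finset.sdiff_sdiff_eq_self hTM]
  set τ : (Fin n → ℚ) → ℝ := fun x => 1 / 2 * ∑ u ∈ S, y u *
        ((if v u = x then 1 else 0) + (if w u = x then 1 else 0)) with hτ
  have hsum : ∀ {E : Type} [AddCommGroup E] [Module ℝ E] (φ : (Fin n → ℚ) → E),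
      ∑ u ∈ S, y u • ((1 / 2 : ℝ) • φ (v u) + (1 / 2 : ℝ) • φ (w u) - φ u) =
        ∑ α ∈ T, τ (ratPt α) • φ (ratPt α) - φ (ratPt β) := fun φ => by
    rw [green_sum hSM hv hw hβS hy φ, hMS, Finset.sum_image fun _ _ _ _ h => ratPt_injective h]
  have hτ1 : ∑ α ∈ T, τ (ratPt α) = 1 := by
    have := hsum fun _ => (1 : ℝ)
    norm_num at this
    linarith
  have hτb : realPt β = ∑ α ∈ T, τ (ratPt α) • realPt α := by
    have := hsum fun x i => (x i : ℝ)
    simp only [ratPt_cast] at this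
    rw [Finset.sum_eq_zero fun u hu => ?_] at this
    · exact (sub_eq_zero.1 this.symm).symm
    · have h0 : (1 / 2 : ℝ) • (fun i => (v u i : ℝ)) + (1 / 2 : ℝ) • (fun i => (w u i : ℝ)) -
          (fun i => (u i : ℝ)) = 0 := by
        funext i
        have := congrFun (h u hu).2.2.2 i
        simp only [Pi.smul_apply, Pi.add_apply, smul_eq_mul] at this
        simp only [Pi.sub_apply, Pi.smul_apply, Pi.add_apply, smul_eq_mul, Pi.zero_apply]
        rw [this]
        push_cast
        ring
      rw [h0, smul_zero]
  have hτwt : ∀ α ∈ T, wt α = τ (ratPt α) :=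
    eq_of_barycentric hT (hwt1.trans hτ1.symm) (hwtb.symm.trans hτb)
  refine ⟨y, hy0, ?_, hτwt, fun φ => ?_⟩
  · rw [hy _ hβS, if_pos rfl]
    refine le_add_of_nonneg_right (mul_nonneg (by norm_num) (Finset.sum_nonneg fun u _ =>
      mul_nonneg (hy0 u) (add_nonneg ?_ ?_))) <;> split_ifs <;> norm_num
  · rw [hsum φ]
    congr 1
    exact Finset.sum_congr rfl fun α hα => by rw [hτwt α hα]

/-! ### The cone of positive semidefinite binary forms -/

/-- The signomial `p x^v + q x^w - r x^((v + w) / 2)`. -/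
noncomputable def binomialForm (v w : Fin n → ℚ) (p q r : ℝ) : RatPoly n :=
  term v p + term w q - term ((1 / 2 : ℚ) • (v + w)) r

theorem term_add (q : Fin n → ℚ) (a b : ℝ) : term q (a + b) = term q a + term q b :=
  AddMonoidAlgebra.single_add _ _ _

theorem term_zero (q : Fin n → ℚ) : term q 0 = 0 := AddMonoidAlgebra.single_zero _

theorem term_sub (q : Fin n → ℚ) (a b : ℝ) : term q (a - b) = term q a - term q b :=
  AddMonoidAlgebra.single_sub _ _ _

theorem smul_term (q : Fin n → ℚ) (a b : ℝ) : a • term q b = term q (a * b) := by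
  simp [term]

/-- Sums over `i ∈ I` of positive semidefinite binary forms in the monomials `x^(v i / 2)` and
`x^(w i / 2)`. -/
noncomputable def binomialCone {ι : Type*} (I : Finset ι) (v w : ι → Fin n → ℚ) :
    AddSubmonoid (RatPoly n) where
  carrier := {h | ∃ p q r : ι → ℝ, (∀ i, 0 ≤ p i ∧ 0 ≤ q i ∧ r i ^ 2 ≤ 4 * p i * q i) ∧
    h = ∑ i ∈ I, binomialForm (v i) (w i) (p i) (q i) (r i)}
  zero_mem' := ⟨0, 0, 0, by simp, by simp [binomialForm, term_zero]⟩
  add_mem' := by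
    rintro _ _ ⟨p, q, r, h, rfl⟩ ⟨p', q', r', h', rfl⟩
    refine ⟨fun i => p i + p' i, fun i => q i + q' i, fun i => r i + r' i, fun i => ?_, ?_⟩
    · obtain ⟨h1, h2, h3⟩ := h i
      obtain ⟨h1', h2', h3'⟩ := h' i
      refine ⟨add_nonneg h1 h1', add_nonneg h2 h2', ?_⟩
      have hx : 0 ≤ p i * q' i := mul_nonneg h1 h2'
      have hy : 0 ≤ p' i * q i := mul_nonneg h1' h2
      -- `(r r')² ≤ 16 (p q') (p' q) ≤ 4 (p q' + p' q)²`, which bounds the cross term `2 r r'`.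
      have hrr : (r i * r' i) ^ 2 ≤ (2 * (p i * q' i + p' i * q i)) ^ 2 := by
        have h4 := mul_le_mul h3 h3' (sq_nonneg _) (by positivity)
        nlinarith [sq_nonneg (p i * q' i - p' i * q i)]
      have := abs_le_of_sq_le_sq hrr (by positivity)
      have h5 := (le_abs_self _).trans this
      nlinarith
    · rw [← Finset.sum_add_distrib]
      refine Finset.sum_congr rfl fun i _ => ?_
      simp only [binomialForm, term_add]
      abel

theorem binomialForm_mem_binomialCone {ι : Type*} {I : Finset ι} {v w : ι → Fin n → ℚ} {i : ι}
    (hi : i ∈ I) {p q r : ℝ} (hp : 0 ≤ p) (hq : 0 ≤ q) (hr : r ^ 2 ≤ 4 * p * q) :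
    binomialForm (v i) (w i) p q r ∈ binomialCone I v w := by
  classical
  refine ⟨fun j => if j = i then p else 0, fun j => if j = i then q else 0,
    fun j => if j = i then r else 0, fun j => ?_, ?_⟩
  · by_cases h : j = i <;> simp [h, hp, hq, hr]
  · rw [Finset.sum_eq_single i (fun j _ hj => by simp [hj, binomialForm, term_zero])
      fun h => absurd hi h]
    simp

theorem binomialCone_le {ι κ : Type*} {I : Finset ι} {J : Finset κ} {v w : ι → Fin n → ℚ}
    (e : κ → ι) (he : ∀ k ∈ J, e k ∈ I) :
    binomialCone J (fun k => v (e k)) (fun k => w (e k)) ≤ binomialCone I v w := by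
  rintro _ ⟨p, q, r, h, rfl⟩
  exact AddSubmonoid.sum_mem _ fun k hk =>
    binomialForm_mem_binomialCone (he k hk) (h k).1 (h k).2.1 (h k).2.2

/-- Completing the square gives `p X² - r X Y + q Y² = (√p X - r/(2√p) Y)² + (q - r²/(4p)) Y²`; if
`p = 0` then `r = 0`. -/
theorem exists_binomial_squares (v w : Fin n → ℚ) {p q r : ℝ} (hp : 0 ≤ p) (hq : 0 ≤ q)
    (hr : r ^ 2 ≤ 4 * p * q) : ∃ a b : Fin 2 → ℝ, binomialForm v w p q r =
      ∑ j, (term ((1 / 2 : ℚ) • v) (a j) - term ((1 / 2 : ℚ) • w) (b j)) ^ 2 := by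
  obtain ⟨a, b, ha, hb, hab⟩ : ∃ a b : Fin 2 → ℝ, a 0 ^ 2 + a 1 ^ 2 = p ∧ b 0 ^ 2 + b 1 ^ 2 = q ∧
      2 * a 0 * b 0 + 2 * a 1 * b 1 = r := by
    rcases hp.eq_or_lt with rfl | hp0
    · have : r = 0 := by
        rw [mul_zero, zero_mul] at hr
        exact pow_eq_zero_iff two_ne_zero |>.1 (le_antisymm hr (sq_nonneg r))
      exact ⟨![0, 0], ![Real.sqrt q, 0], by simp, by simp [Real.sq_sqrt hq], by simp [this]⟩
    · have hsp : 0 < Real.sqrt p := Real.sqrt_pos.2 hp0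
      have hsq : Real.sqrt p ^ 2 = p := Real.sq_sqrt hp
      have hq' : 0 ≤ q - r ^ 2 / (4 * p) := by
        rw [sub_nonneg, div_le_iff₀ (by positivity)]; linarith
      refine ⟨![Real.sqrt p, 0], ![r / (2 * Real.sqrt p), Real.sqrt (q - r ^ 2 / (4 * p))],
        by simp [hsq], ?_, ?_⟩
      · simp only [Matrix.cons_val_zero, Matrix.cons_val_one, Real.sq_sqrt hq', div_pow, mul_pow,
          hsq]
        ring
      · simp only [Matrix.cons_val_zero, Matrix.cons_val_one]
        field_simp
        ring
  refine ⟨a, b, ?_⟩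
  rw [Fin.sum_univ_two, binomial_sq rfl, binomial_sq rfl, binomialForm, ← ha, ← hb, ← hab]
  simp only [term_add]
  abel

theorem exists_squares_of_mem_binomialCone {ι : Type*} {I : Finset ι} {v w : ι → Fin n → ℚ}
    {h : RatPoly n} (hh : h ∈ binomialCone I v w) : ∃ a b : ι → Fin 2 → ℝ,
      h = ∑ i ∈ I, ∑ j, (term ((1 / 2 : ℚ) • v i) (a i j) -
        term ((1 / 2 : ℚ) • w i) (b i j)) ^ 2 := by
  obtain ⟨p, q, r, hpq, rfl⟩ := hh
  choose a b hab using fun i => exists_binomial_squares (v i) (w i) (hpq i).1 (hpq i).2.1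
    (hpq i).2.2
  exact ⟨a, b, Finset.sum_congr rfl fun i _ => hab i⟩

/-! ### Circuits as sums of binomial squares -/

/-- Placed at height 1, affinely independent points become linearly independent, and a functional
prescribed on them extends to the whole space. -/
theorem exists_affine_interpolation {T : Finset (Fin n →₀ ℕ)}
    (hT : AffineIndependent ℝ (fun α : T => realPt (α : Fin n →₀ ℕ))) (t : (Fin n →₀ ℕ) → ℝ) :
    ∃ (c : ℝ) (l : Fin n → ℝ), ∀ α ∈ T, c + ∑ i, (α i : ℝ) * l i = t α := by
  have hli : LinearIndependent ℝ (fun α : T => ((1 : ℝ), realPt (α : Fin n →₀ ℕ))) := by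
    rw [linearIndependent_iff']
    intro s g hg
    rw [Prod.ext_iff, Prod.fst_sum, Prod.snd_sum] at hg
    exact affineIndependent_iff.1 hT s g (by simpa using hg.1) (by simpa using hg.2)
  obtain ⟨φ, hφ⟩ := LinearMap.exists_extend
    ((Module.Basis.span hli).constr ℝ fun α : T => t α)
  refine ⟨φ (1, 0), fun i => φ (0, Pi.single i 1), fun α hα => ?_⟩
  have h1 : φ (1, realPt α) = t α := by
    have h2 := LinearMap.congr_fun hφ (Module.Basis.span hli ⟨α, hα⟩)
    rw [Module.Basis.constr_basis] at h2
    simpa [Module.Basis.span_apply] using h2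
  rw [← h1]
  have h3 : ((1 : ℝ), realPt α) = (1, 0) + ∑ i, (α i : ℝ) • ((0 : ℝ), (Pi.single i 1 : Fin n → ℝ)) := by
    ext j
    · simp [Prod.fst_sum]
    · simp [Prod.snd_sum, Finset.sum_apply, Pi.single_apply, realPt]
  rw [h3, map_add, map_sum]
  simp only [map_smul, smul_eq_mul]

/-- The walk exits at `α` with positive probability, so `α` is an endpoint of some `u`, and the
monomial is a degenerate form at that `u`. -/
theorem vertex_mem_binomialCone {T : Finset (Fin n →₀ ℕ)} {β : Fin n →₀ ℕ}
    {M : Finset (Fin n → ℚ)} {v w : (Fin n → ℚ) → Fin n → ℚ} (hT : IsCircuit T β) (hβT : β ∉ T)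
    (hTM : T.image ratPt ⊆ M) (hβM : ratPt β ∈ M)
    (h : ∀ u ∈ M \ T.image ratPt, v u ∈ M ∧ w u ∈ M ∧ v u ≠ w u ∧ u = (1 / 2 : ℚ) • (v u + w u))
    {α : Fin n →₀ ℕ} (hα : α ∈ T) {c : ℝ} (hc : 0 ≤ c) :
    term (ratPt α) c ∈ binomialCone (M \ T.image ratPt) v w := by
  obtain ⟨wt, hwt, hwt1, hwtb⟩ := hT.mem_interior
  obtain ⟨y, -, -, hy, -⟩ :=
    exists_green_of_mediated hT.trellis.affineIndependent hβT hTM hβM h hwt1 hwtb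
  obtain ⟨u, hu, hvw⟩ : ∃ u ∈ M \ T.image ratPt, v u = ratPt α ∨ w u = ratPt α := by
    by_contra! hcon
    have h0 := hwt α hα
    rw [hy α hα, Finset.sum_eq_zero fun u hu => ?_] at h0
    · simp at h0
    · rw [if_neg (hcon u hu).1, if_neg (hcon u hu).2]
      simp
  rcases hvw with h1 | h1
  · simpa [binomialForm, term_zero, h1] using
      binomialForm_mem_binomialCone (v := v) (w := w) hu (p := c) (q := 0) (r := 0) hc le_rfl
        (by simp)
  · simpa [binomialForm, term_zero, h1] using
      binomialForm_mem_binomialCone (v := v) (w := w) hu (p := 0) (q := c) (r := 0) le_rfl hc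
        (by simp)

/-- Choose `e`, the exponential of an affine function, with `wt α * e α = C α` on `T`; then `e β` is
the AM-GM constant, so `|d| ≤ D ≤ e β`. The Green identity for `φ x = e x • x^x` writes the circuit
polynomial with `d = e β` as a sum of forms that are perfect squares up to scale, since `e u ^ 2 = e
v * e w`. Replacing `e β` by `d` alters only the middle coefficient at `u = β`, which becomes `(y β
- 1) * e β + d`; since `y β ≥ 1`, its absolute value is at most `y β * e β`. -/
theorem circuit_mem_binomialCone {T : Finset (Fin n →₀ ℕ)} {β : Fin n →₀ ℕ}
    {M : Finset (Fin n → ℚ)} {v w : (Fin n → ℚ) → Fin n → ℚ} (hT : IsCircuit T β) (hβT : β ∉ T)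
    (hTM : T.image ratPt ⊆ M) (hβM : ratPt β ∈ M)
    (h : ∀ u ∈ M \ T.image ratPt, v u ∈ M ∧ w u ∈ M ∧ v u ≠ w u ∧ u = (1 / 2 : ℚ) • (v u + w u))
    {C : (Fin n →₀ ℕ) → ℝ} {D d : ℝ} (hCD : CircuitBound T β C D) (hd : |d| ≤ D) :
    ∑ α ∈ T, term (ratPt α) (C α) - term (ratPt β) d ∈
      binomialCone (M \ T.image ratPt) v w := by
  obtain ⟨wt, hwt, hwt1, hwtb, hC, -, hD⟩ := hCD
  obtain ⟨y, hy0, hy1, -, hy⟩ :=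
    exists_green_of_mediated hT.trellis.affineIndependent hβT hTM hβM h hwt1 hwtb
  obtain ⟨c, l, hcl⟩ := exists_affine_interpolation hT.trellis.affineIndependent
    fun α => Real.log (C α / wt α)
  set e : (Fin n → ℚ) → ℝ := fun x => Real.exp (c + ∑ i, (x i : ℝ) * l i) with he
  have he0 : ∀ x, 0 < e x := fun x => Real.exp_pos _
  have heα : ∀ α ∈ T, wt α * e (ratPt α) = C α := fun α hα => by
    simp only [he]
    rw [sum_ratPt_mul, hcl α hα, Real.exp_log (div_pos (hC α hα) (hwt α hα)),
      mul_div_cancel₀ _ (hwt α hα).ne']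
  have heβ : D ≤ e (ratPt β) := by
    refine hD.trans_eq ?_
    simp only [he]
    rw [sum_ratPt_mul]
    congr 1
    have hβi : ∀ i, (β i : ℝ) = ∑ α ∈ T, wt α * (α i : ℝ) := fun i => by
      have := congrFun hwtb i
      simpa [realPt, Finset.sum_apply] using this
    calc ∑ α ∈ T, wt α * Real.log (C α / wt α)
        = ∑ α ∈ T, (wt α * c + ∑ i, wt α * (α i : ℝ) * l i) := by
          refine Finset.sum_congr rfl fun α hα => ?_
          rw [← hcl α hα, mul_add, Finset.mul_sum]
          simp only [mul_assoc]
      _ = c + ∑ i, (β i : ℝ) * l i := by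
          rw [Finset.sum_add_distrib, ← Finset.sum_mul, hwt1, one_mul, Finset.sum_comm]
          simp only [hβi, Finset.sum_mul]
  have hemid : ∀ x z : Fin n → ℚ, e ((1 / 2 : ℚ) • (x + z)) ^ 2 = e x * e z := fun x z => by
    simp only [he]
    rw [← Real.exp_add, sq, ← Real.exp_add]
    congr 1
    have : ∀ i, ((((1 / 2 : ℚ) • (x + z)) i : ℚ) : ℝ) * l i = ((x i : ℝ) * l i + z i * l i) / 2 :=
      fun i => by
        simp only [Pi.smul_apply, Pi.add_apply, smul_eq_mul]
        push_cast
        ring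
    simp only [this, ← Finset.sum_div, Finset.sum_add_distrib]
    ring
  have hβS : ratPt β ∈ M \ T.image ratPt := by
    refine Finset.mem_sdiff.2 ⟨hβM, fun hmem => ?_⟩
    obtain ⟨α, hα, hαβ⟩ := Finset.mem_image.1 hmem
    exact hβT (ratPt_injective hαβ ▸ hα)
  have hsum : ∑ α ∈ T, term (ratPt α) (C α) - term (ratPt β) d =
      ∑ u ∈ M \ T.image ratPt, binomialForm (v u) (w u) (1 / 2 * y u * e (v u))
        (1 / 2 * y u * e (w u)) (y u * e u + if u = ratPt β then d - e u else 0) := by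
    have h1 := hy fun x => term x (e x)
    simp only [smul_term, smul_add, smul_sub] at h1
    rw [Finset.sum_congr (s₁ := T) rfl fun α hα => by rw [heα α hα]] at h1
    have h2 : ∀ u ∈ M \ T.image ratPt, binomialForm (v u) (w u) (1 / 2 * y u * e (v u))
        (1 / 2 * y u * e (w u)) (y u * e u + if u = ratPt β then d - e u else 0) =
        (term (v u) (y u * (1 / 2 * e (v u))) + term (w u) (y u * (1 / 2 * e (w u))) -
          term u (y u * e u)) - if u = ratPt β then term u (d - e u) else 0 := by
      intro u hu
      rw [binomialForm, ← (h u hu).2.2.2, term_add]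
      have h3 : ∀ s t : ℝ, 1 / 2 * s * t = s * (1 / 2 * t) := fun s t => by ring
      rw [h3, h3]
      split_ifs
      · abel
      · rw [term_zero]; abel
    rw [Finset.sum_congr rfl h2, Finset.sum_sub_distrib, h1, Finset.sum_ite_eq', if_pos hβS,
      term_sub]
    abel
  rw [hsum]
  refine AddSubmonoid.sum_mem _ fun u hu => ?_
  have hp : ∀ x, 0 ≤ 1 / 2 * y u * e x := fun x =>
    mul_nonneg (mul_nonneg (by norm_num) (hy0 u)) (he0 x).le
  refine binomialForm_mem_binomialCone hu (hp _) (hp _) ?_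
  have h4 : 4 * (1 / 2 * y u * e (v u)) * (1 / 2 * y u * e (w u)) = (y u * e u) ^ 2 := by
    have := hemid (v u) (w u)
    rw [← (h u hu).2.2.2] at this
    rw [mul_pow, this]
    ring
  rw [h4]
  refine sq_le_sq' ?_ ?_
  · split_ifs with huβ
    · subst huβ
      have h5 := mul_le_mul_of_nonneg_right hy1 (he0 (ratPt β)).le
      have h6 := (abs_le.1 hd).1
      linarith
    · have := mul_nonneg (hy0 u) (he0 u).le
      linarith
  · split_ifs with huβ
    · subst huβ
      have h6 := (abs_le.1 hd).2
      linarith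
    · linarith

theorem mem_leftover {f : MvPolynomial (Fin n) ℝ} {α : Fin n →₀ ℕ} :
    α ∈ leftover f ↔ α ∈ posPart f ∧ ∀ β ∈ negPart f, ∀ T ∈ circuits f β, α ∉ T := by
  simp [leftover]

theorem HasCircuitDecomposition.exists_binomial_squares {f : MvPolynomial (Fin n) ℝ}
    (hf : HasCircuitDecomposition f)
    {M : (Fin n →₀ ℕ) → Finset (Fin n →₀ ℕ) → Finset (Fin n → ℚ)}
    {v w : (Fin n →₀ ℕ) → Finset (Fin n →₀ ℕ) → (Fin n → ℚ) → (Fin n → ℚ)}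
    (hM : ∀ β ∈ negPart f, ∀ T ∈ circuits f β, IsOddMediatedSet T β (M β T))
    (hvw : ∀ β ∈ negPart f, ∀ T ∈ circuits f β, ∀ u ∈ M β T \ T.image ratPt,
      v β T u ∈ M β T ∧ w β T u ∈ M β T ∧ v β T u ≠ w β T u ∧
        u = (1 / 2 : ℚ) • (v β T u + w β T u)) :
    ∃ a b : (Fin n →₀ ℕ) → Finset (Fin n →₀ ℕ) → (Fin n → ℚ) → Fin 2 → ℝ,
      toRatPoly f = (∑ β ∈ negPart f, ∑ T ∈ circuits f β, ∑ u ∈ M β T \ T.image ratPt,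
        ∑ j : Fin 2, (term ((1 / 2 : ℚ) • v β T u) (a β T u j)
          - term ((1 / 2 : ℚ) • w β T u) (b β T u j)) ^ 2)
        + ∑ α ∈ leftover f, term (ratPt α) (f.coeff α) := by
  obtain ⟨C, D, hD, hC, h⟩ := hf
  -- A single cone over all triples `(β, T, u)`: circuit parts and vertex remainders falling on the
  -- same triple merge into one form, so two squares per triple suffice.
  set I : Finset ((_ : Fin n →₀ ℕ) × (_ : Finset (Fin n →₀ ℕ)) × (Fin n → ℚ)) :=
    (negPart f).sigma fun β => (circuits f β).sigma fun T => M β T \ T.image ratPt with hI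
  set Q := binomialCone I (fun i => v i.1 i.2.1 i.2.2) (fun i => w i.1 i.2.1 i.2.2) with hQ
  have hle : ∀ β ∈ negPart f, ∀ T ∈ circuits f β,
      binomialCone (M β T \ T.image ratPt) (v β T) (w β T) ≤ Q := by
    intro β hβ T hT
    refine binomialCone_le (I := I) (v := fun i => v i.1 i.2.1 i.2.2)
      (w := fun i => w i.1 i.2.1 i.2.2) (fun u => ⟨β, T, u⟩) fun u hu => ?_
    rw [hI, Finset.mem_sigma, Finset.mem_sigma]
    exact ⟨hβ, hT, hu⟩
  have hβT : ∀ β ∈ negPart f, ∀ T ∈ circuits f β, β ∉ T := fun β hβ T hT hmem =>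
    (Finset.mem_sdiff.1 hβ).2 ((mem_circuits.1 hT).1 hmem)
  have hTM : ∀ β ∈ negPart f, ∀ T ∈ circuits f β, T.image ratPt ⊆ M β T := fun β hβ T hT x hx => by
    obtain ⟨α, hα, rfl⟩ := Finset.mem_image.1 hx
    exact (hM β hβ T hT).mediated.1 (Set.mem_image_of_mem _ hα)
  have hrep := sum_circuits_add_remainder hD (fun β hβ T hT => (h β hβ T hT).1)
    fun α => (⟨⟨term (ratPt α), term_zero _⟩, term_add _⟩ : ℝ →+ RatPoly n)
  simp only [AddMonoidHom.coe_mk, ZeroHom.coe_mk] at hrep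
  have hlsub : leftover f ⊆ posPart f := fun α hα => (mem_leftover.1 hα).1
  have hleft : ∀ α ∈ leftover f, f.coeff α -
      ∑ β ∈ negPart f, ∑ T ∈ circuits f β, C β T α = f.coeff α := fun α hα => by
    rw [Finset.sum_eq_zero, sub_zero]
    exact fun β hβ => Finset.sum_eq_zero fun T hT =>
      (h β hβ T hT).1 α ((mem_leftover.1 hα).2 β hβ T hT)
  have hcirc : ∑ β ∈ negPart f, ∑ T ∈ circuits f β, (∑ α ∈ T, term (ratPt α) (C β T α) -
      term (ratPt β) (-SignType.sign (f.coeff β) * D β T)) ∈ Q := by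
    refine AddSubmonoid.sum_mem _ fun β hβ => AddSubmonoid.sum_mem _ fun T hT => ?_
    refine hle β hβ T hT ?_
    rcases (h β hβ T hT).2 with ⟨h1, h2⟩ | hb
    · simp [h1, h2, term_zero]
    · refine circuit_mem_binomialCone (mem_circuits.1 hT).2 (hβT β hβ T hT) (hTM β hβ T hT)
        (hM β hβ T hT).mem (hvw β hβ T hT) hb ?_
      obtain ⟨-, -, -, -, -, hD0, -⟩ := hb
      rw [abs_mul, abs_neg, abs_of_nonneg hD0]
      refine mul_le_of_le_one_left hD0 ?_
      rcases SignType.trichotomy (SignType.sign (f.coeff β)) with hs | hs | hs <;> simp [hs]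
  have hrest : ∑ α ∈ posPart f \ leftover f, term (ratPt α)
      (f.coeff α - ∑ β ∈ negPart f, ∑ T ∈ circuits f β, C β T α) ∈ Q := by
    refine AddSubmonoid.sum_mem _ fun α hα => ?_
    obtain ⟨hα1, hα2⟩ := Finset.mem_sdiff.1 hα
    rw [mem_leftover] at hα2
    push Not at hα2
    obtain ⟨β, hβ, T, hT, hαT⟩ := hα2 hα1
    exact hle β hβ T hT (vertex_mem_binomialCone (mem_circuits.1 hT).2 (hβT β hβ T hT)
      (hTM β hβ T hT) (hM β hβ T hT).mem (hvw β hβ T hT) hαT (sub_nonneg.2 (hC α hα1)))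
  obtain ⟨a, b, hab⟩ := exists_squares_of_mem_binomialCone (Q.add_mem hcirc hrest)
  refine ⟨fun β T u => a ⟨β, T, u⟩, fun β T u => b ⟨β, T, u⟩, ?_⟩
  rw [toRatPoly, hrep, ← Finset.sum_sdiff hlsub, ← add_assoc, hab,
    Finset.sum_congr (s₁ := leftover f) rfl fun α hα => by rw [hleft α hα], hI, Finset.sum_sigma]
  congr 1
  exact Finset.sum_congr rfl fun β _ => Finset.sum_sigma _ _ _

/-! ### Existence of mediated sets -/

/-- The points `x` of `conv T` with `N x ∈ (2ℤ)ⁿ`. -/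
def evenGrid (T : Finset (Fin n →₀ ℕ)) (N : ℕ) : Set (Fin n → ℚ) :=
  {x | (∀ i, ∃ a : ℤ, x i * N = 2 * a) ∧ ∃ μ : (Fin n →₀ ℕ) → ℝ, (∀ α ∈ T, 0 ≤ μ α) ∧
    ∑ α ∈ T, μ α = 1 ∧ ∀ i, (x i : ℝ) = ∑ α ∈ T, μ α * α i}

theorem evenGrid_finite (T : Finset (Fin n →₀ ℕ)) {N : ℕ} (hN : 0 < N) : (evenGrid T N).Finite := by
  have hNq : (0 : ℚ) < N := by exact_mod_cast hN
  refine Set.Finite.subset (s := Set.pi Set.univ fun i : Fin n =>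
    (fun a : ℤ => (2 * a / N : ℚ)) '' Set.Icc 0 (N * ∑ α ∈ T, (α i : ℤ)))
    (Set.Finite.pi fun i => (Set.finite_Icc _ _).image _) ?_
  rintro x ⟨hx, μ, hμ, hμ1, hxμ⟩ i -
  obtain ⟨a, ha⟩ := hx i
  refine ⟨a, ?_, by dsimp only; rw [← ha]; field_simp⟩
  have h0 : (0 : ℝ) ≤ x i := by
    rw [hxμ]; exact Finset.sum_nonneg fun α hα => mul_nonneg (hμ α hα) (Nat.cast_nonneg _)
  have h1 : (x i : ℝ) ≤ ((∑ α ∈ T, (α i : ℤ) : ℤ) : ℝ) := by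
    rw [hxμ]
    push_cast
    refine Finset.sum_le_sum fun α hα => mul_le_of_le_one_left (Nat.cast_nonneg _) ?_
    rw [← hμ1]
    exact Finset.single_le_sum hμ hα
  have h0' : (0 : ℚ) ≤ x i := by exact_mod_cast h0
  have h1' : x i ≤ ((∑ α ∈ T, (α i : ℤ) : ℤ) : ℚ) := by exact_mod_cast h1
  have h2 : (0 : ℚ) ≤ 2 * a := by rw [← ha]; positivity
  have h3 : (2 * a : ℚ) ≤ N * ((∑ α ∈ T, (α i : ℤ) : ℤ) : ℚ) := by
    rw [← ha, mul_comm]; gcongr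
  constructor
  · have : (0 : ℤ) ≤ 2 * a := by exact_mod_cast h2
    omega
  · have h4 : (2 * a : ℤ) ≤ N * ∑ α ∈ T, (α i : ℤ) := by exact_mod_cast h3
    have h5 : (0 : ℤ) ≤ 2 * a := by exact_mod_cast h2
    omega

theorem isEvenRatPt_of_mem_evenGrid {T : Finset (Fin n →₀ ℕ)} {N : ℕ} (hN : Odd N)
    {x : Fin n → ℚ} (hx : x ∈ evenGrid T N) : IsEvenRatPt x := by
  intro i
  obtain ⟨a, ha⟩ := hx.1 i
  have hNq : (N : ℚ) ≠ 0 := by exact_mod_cast hN.pos.ne'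
  exact odd_den_even_num_iff.2 ⟨a, N, hN, by rw [← ha]; field_simp⟩

theorem ratPt_mem_evenGrid {T : Finset (Fin n →₀ ℕ)} {α : Fin n →₀ ℕ} (hα : α ∈ T)
    (he : IsEvenPt α) (N : ℕ) : ratPt α ∈ evenGrid T N := by
  classical
  refine ⟨fun i => ?_, fun γ => if γ = α then 1 else 0, fun γ _ => ?_, ?_, fun i => ?_⟩
  · obtain ⟨k, hk⟩ := he i
    refine ⟨k * N, ?_⟩
    simp only [ratPt, hk]
    push_cast
    ring
  · dsimp only
    split_ifs <;> norm_num
  · simp [hα]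
  · simp [hα, ratPt]

/-- A point of the grid that is not a vertex is the midpoint of two other points of the grid. -/
theorem mem_ratMidpoints_of_mem_evenGrid {T : Finset (Fin n →₀ ℕ)} (hT : ∀ α ∈ T, IsEvenPt α)
    {N : ℕ} (hN0 : 0 < N) (hN : 2 * T.card ≤ N) {x : Fin n → ℚ} (hx : x ∈ evenGrid T N)
    (hxT : ∀ α ∈ T, x ≠ ratPt α) : x ∈ ratMidpoints (evenGrid T N) := by
  classical
  obtain ⟨hxN, μ, hμ, hμ1, hxμ⟩ := hx
  have hNq : (N : ℚ) ≠ 0 := by exact_mod_cast hN0.ne'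
  have hNr : (0 : ℝ) < N := by exact_mod_cast hN0
  have hsingle : ∀ α ∈ T, ∀ i, ∑ γ ∈ T, (if γ = α then (1 : ℝ) else 0) * (γ i : ℝ) = α i :=
    fun α hα i => by simp [hα]
  have hsingle1 : ∀ α ∈ T, ∑ γ ∈ T, (if γ = α then (1 : ℝ) else 0) = 1 :=
    fun α hα => by simp [hα]
  -- If a vertex `α` has weight at least 1/2, then `2x - α` remains in the simplex. Otherwise, since
  -- `N ≥ 2 |T|`, two distinct vertices have weight at least `1/N`, and `x` can be moved both ways
  -- by `(α - α') / N`, which preserves the grid because vertices are even.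
  by_cases hbig : ∃ α ∈ T, 1 / 2 ≤ μ α
  · obtain ⟨α, hα, hμα⟩ := hbig
    refine ⟨ratPt α, ratPt_mem_evenGrid hα (hT α hα) N, (2 : ℚ) • x - ratPt α,
      ⟨fun i => ?_, fun γ => 2 * μ γ - if γ = α then 1 else 0, fun γ hγ => ?_, ?_, fun i => ?_⟩,
      fun h => hxT α hα ?_, ?_⟩
    · obtain ⟨a, ha⟩ := hxN i
      obtain ⟨k, hk⟩ := hT α hα i
      refine ⟨2 * a - k * N, ?_⟩
      simp only [Pi.sub_apply, Pi.smul_apply, smul_eq_mul, ratPt, hk]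
      push_cast
      linear_combination 2 * ha
    · have := hμ γ hγ
      dsimp only
      split_ifs with h
      · rw [h]; linarith
      · linarith
    · rw [Finset.sum_sub_distrib, ← Finset.mul_sum, hμ1, hsingle1 α hα]; norm_num
    · simp only [sub_mul, Finset.sum_sub_distrib, hsingle α hα, mul_assoc, ← Finset.mul_sum, ← hxμ]
      simp [ratPt]
    · funext i
      have := congrFun h i
      simp only [Pi.sub_apply, Pi.smul_apply, smul_eq_mul] at this
      linarith
    · rw [add_sub_cancel, smul_smul]; norm_num
  · push Not at hbig
    have hTne : T.Nonempty := by
      rw [Finset.nonempty_iff_ne_empty]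
      rintro rfl
      simp at hμ1
    have hNc : 2 * (T.card : ℝ) ≤ N := by exact_mod_cast hN
    have hex : ∀ s ⊆ T, 1 / 2 < ∑ γ ∈ s, μ γ → ∃ γ ∈ s, 1 / (N : ℝ) ≤ μ γ := by
      intro s hs hsum
      by_contra! hcon
      have h1 : ∑ γ ∈ s, μ γ ≤ s.card • (1 / (N : ℝ)) :=
        Finset.sum_le_card_nsmul _ _ _ fun γ hγ => (hcon γ hγ).le
      have h2 : (s.card : ℝ) ≤ T.card := by exact_mod_cast Finset.card_le_card hs
      have h3 : s.card • (1 / (N : ℝ)) ≤ 1 / 2 := by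
        rw [nsmul_eq_mul, mul_one_div, div_le_div_iff₀ hNr (by norm_num)]
        linarith
      linarith
    obtain ⟨α, hα, hμα⟩ := hex T subset_rfl (by rw [hμ1]; norm_num)
    obtain ⟨α', hα', hμα'⟩ := hex (T.erase α) (Finset.erase_subset _ _) (by
      have := Finset.add_sum_erase T μ hα
      have := hbig α hα
      linarith)
    obtain ⟨hne, hα'T⟩ := Finset.mem_erase.1 hα'
    have key : ∀ s : ℤ, (s = 1 ∨ s = -1) →
        x + ((s : ℚ) / N) • (ratPt α - ratPt α') ∈ evenGrid T N := by
      intro s hs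
      refine ⟨fun i => ?_, fun γ => μ γ + ((s : ℝ) / N) *
        ((if γ = α then 1 else 0) - if γ = α' then 1 else 0), fun γ hγ => ?_, ?_, fun i => ?_⟩
      · obtain ⟨a, ha⟩ := hxN i
        obtain ⟨k, hk⟩ := hT α hα i
        obtain ⟨k', hk'⟩ := hT α' hα'T i
        refine ⟨a + s * (k - k'), ?_⟩
        simp only [Pi.add_apply, Pi.sub_apply, Pi.smul_apply, smul_eq_mul, ratPt, hk, hk']
        push_cast
        rw [add_mul, ha]
        field_simp
        ring
      · have h0 := hμ γ hγ
        have h1 : 0 < 1 / (N : ℝ) := by positivity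
        dsimp only
        by_cases h2 : γ = α
        · have h3 : γ ≠ α' := fun h => hne (h.symm.trans h2)
          subst h2
          rw [if_pos rfl, if_neg h3]
          rcases hs with rfl | rfl <;> push_cast
          · linarith
          · rw [neg_div]; linarith
        · by_cases h3 : γ = α'
          · subst h3
            rw [if_neg h2, if_pos rfl]
            rcases hs with rfl | rfl <;> push_cast
            · linarith
            · rw [neg_div]; linarith
          · rw [if_neg h2, if_neg h3]
            simpa using h0
      · rw [Finset.sum_add_distrib, ← Finset.mul_sum, Finset.sum_sub_distrib, hsingle1 α hα,
          hsingle1 α' hα'T, hμ1]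
        ring
      · simp only [add_mul, Finset.sum_add_distrib, mul_assoc, ← Finset.mul_sum, ← hxμ, sub_mul,
          Finset.sum_sub_distrib]
        rw [hsingle α hα, hsingle α' hα'T]
        simp [ratPt]
    refine ⟨_, key 1 (.inl rfl), _, key (-1) (.inr rfl), fun h => hne ?_, ?_⟩
    · apply ratPt_injective
      funext i
      have h1 := congrFun h i
      simp only [Pi.add_apply, Pi.sub_apply, Pi.smul_apply, smul_eq_mul] at h1
      push_cast at h1
      field_simp at h1
      linarith
    · funext i
      simp only [Pi.add_apply, Pi.sub_apply, Pi.smul_apply, smul_eq_mul]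
      push_cast
      ring

/-- A lattice point in the relative interior of `conv T` is the midpoint of two points of a fine
enough grid. -/
theorem exists_evenGrid_midpoint {T : Finset (Fin n →₀ ℕ)} (hT : ∀ α ∈ T, IsEvenPt α)
    {β : Fin n →₀ ℕ} {wt : (Fin n →₀ ℕ) → ℝ} (hwt : ∀ α ∈ T, 0 < wt α) (hwt1 : ∑ α ∈ T, wt α = 1)
    (hwtb : realPt β = ∑ α ∈ T, wt α • realPt α) {α₀ : Fin n →₀ ℕ} (hα₀ : α₀ ∈ T) {N : ℕ}
    (hN0 : 0 < N) (hN : T.card ≤ wt α₀ * N) :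
    ∃ v ∈ evenGrid T N, ∃ w ∈ evenGrid T N, ratPt β = (1 / 2 : ℚ) • (v + w) := by
  classical
  have hNq : (N : ℚ) ≠ 0 := by exact_mod_cast hN0.ne'
  have hNr : (0 : ℝ) < N := by exact_mod_cast hN0
  -- Round `wt * N` to integers of sum `N`, with all rounding defects put on `α₀`. They total at
  -- most `|T| ≤ wt α₀ * N`, so `k ≤ 2 * wt * N`, and both `v = ∑ (k α / N) α` and its reflection
  -- `2β - v` lie in the simplex.
  set k : (Fin n →₀ ℕ) → ℤ := fun α => if α = α₀ then N - ∑ γ ∈ T.erase α₀, ⌊wt γ * N⌋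
    else ⌊wt α * N⌋ with hk
  have hksum : ∑ α ∈ T, k α = N := by
    rw [← Finset.add_sum_erase T k hα₀]
    have : ∑ α ∈ T.erase α₀, k α = ∑ γ ∈ T.erase α₀, ⌊wt γ * N⌋ :=
      Finset.sum_congr rfl fun γ hγ => by simp [hk, Finset.ne_of_mem_erase hγ]
    rw [this]
    simp [hk]
  have hk0 : ∀ α ∈ T, (0 : ℝ) ≤ k α ∧ (k α : ℝ) ≤ 2 * (wt α * N) := by
    intro α hα
    have hpos : 0 < wt α * N := mul_pos (hwt α hα) hNr
    by_cases h : α = α₀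
    · subst h
      have h1 : wt α * N + ∑ γ ∈ T.erase α, wt γ * N = N := by
        rw [Finset.add_sum_erase T (fun γ => wt γ * N) hα, ← Finset.sum_mul, hwt1, one_mul]
      have h2 : ∑ γ ∈ T.erase α, (⌊wt γ * N⌋ : ℝ) ≤ ∑ γ ∈ T.erase α, wt γ * N :=
        Finset.sum_le_sum fun γ _ => Int.floor_le _
      have h3 : ∑ γ ∈ T.erase α, (wt γ * N - ⌊wt γ * N⌋) ≤ (T.erase α).card • (1 : ℝ) :=
        Finset.sum_le_card_nsmul _ _ _ fun γ _ => by
          have := Int.sub_one_lt_floor (wt γ * N); linarith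
      have h4 : ((T.erase α).card : ℝ) ≤ T.card := by
        exact_mod_cast Finset.card_le_card (Finset.erase_subset _ _)
      rw [Finset.sum_sub_distrib, nsmul_eq_mul, mul_one] at h3
      simp only [hk, if_true]
      push_cast
      constructor <;> linarith
    · simp only [hk, if_neg h]
      refine ⟨by exact_mod_cast Int.floor_nonneg.2 hpos.le, ?_⟩
      have := Int.floor_le (wt α * N)
      linarith
  have hβi : ∀ i, (β i : ℝ) = ∑ α ∈ T, wt α * (α i : ℝ) := fun i => by
    have := congrFun hwtb i
    simpa [realPt, Finset.sum_apply] using this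
  have heven : ∀ i, ∃ a : ℤ, ∑ α ∈ T, k α * (α i : ℤ) = 2 * a := fun i =>
    Finset.dvd_sum fun α hα => Dvd.dvd.mul_left
      (by exact_mod_cast (hT α hα i).two_dvd) _
  set v : Fin n → ℚ := fun i => ((∑ α ∈ T, k α * (α i : ℤ) : ℤ) : ℚ) / N with hv
  have hvr : ∀ i, (v i : ℝ) = ∑ α ∈ T, (k α : ℝ) / N * α i := fun i => by
    simp only [hv]
    push_cast
    rw [Finset.sum_div]
    exact Finset.sum_congr rfl fun α _ => by ring
  have hkr : ∑ α ∈ T, (k α : ℝ) / N = 1 := by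
    rw [← Finset.sum_div, div_eq_one_iff_eq hNr.ne']
    exact_mod_cast hksum
  refine ⟨v, ⟨fun i => ?_, fun α => k α / N, fun α hα => div_nonneg (hk0 α hα).1 hNr.le, hkr, hvr⟩,
    (2 : ℚ) • ratPt β - v, ⟨fun i => ?_, fun α => 2 * wt α - k α / N, fun α hα => ?_, ?_,
      fun i => ?_⟩, ?_⟩
  · obtain ⟨a, ha⟩ := heven i
    refine ⟨a, ?_⟩
    simp only [hv]
    rw [div_mul_cancel₀ _ hNq, ha]
    push_cast
    rfl
  · obtain ⟨a, ha⟩ := heven i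
    refine ⟨β i * N - a, ?_⟩
    simp only [hv, Pi.sub_apply, Pi.smul_apply, smul_eq_mul, ratPt]
    rw [sub_mul, div_mul_cancel₀ _ hNq, ha]
    push_cast
    ring
  · rw [sub_nonneg, div_le_iff₀ hNr, mul_assoc]
    exact (hk0 α hα).2
  · rw [Finset.sum_sub_distrib, ← Finset.mul_sum, hwt1, hkr]; norm_num
  · simp only [Pi.sub_apply, Pi.smul_apply, smul_eq_mul, ratPt, sub_mul, Finset.sum_sub_distrib,
      mul_assoc, ← Finset.mul_sum, ← hβi]
    push_cast
    rw [hvr]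
  · rw [add_sub_cancel, smul_smul]; norm_num

theorem exists_isOddMediatedSet {T : Finset (Fin n →₀ ℕ)} {β : Fin n →₀ ℕ} (h : IsCircuit T β) :
    ∃ M : Finset (Fin n → ℚ), IsOddMediatedSet T β M := by
  classical
  obtain ⟨wt, hwt, hwt1, hwtb⟩ := h.mem_interior
  obtain ⟨α₀, hα₀⟩ := h.trellis.nonempty
  have hTe := h.trellis.even
  obtain ⟨K, hK⟩ := exists_nat_ge (T.card / wt α₀)
  -- `N` is odd for the denominators, at least `2 |T|` for midpoints within the grid, and at least
  -- `|T| / wt α₀` for the midpoint at `β`.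
  set N := 2 * (K + T.card) + 1 with hN
  have hN0 : 0 < N := by omega
  have hNodd : Odd N := ⟨_, rfl⟩
  have hNwt : (T.card : ℝ) ≤ wt α₀ * N := by
    rw [div_le_iff₀ (hwt α₀ hα₀)] at hK
    have h1 : (K : ℝ) ≤ N := by exact_mod_cast (by omega : K ≤ N)
    have := mul_le_mul_of_nonneg_left h1 (hwt α₀ hα₀).le
    linarith
  have hfin := evenGrid_finite T hN0
  have hmono : evenGrid T N ⊆ insert (ratPt β) (evenGrid T N) := Set.subset_insert _ _
  have hmid : ∀ x, x ∈ ratMidpoints (evenGrid T N) →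
      x ∈ ratMidpoints (insert (ratPt β) (evenGrid T N)) := by
    rintro x ⟨v, hv, w, hw, hvw⟩
    exact ⟨v, hmono hv, w, hmono hw, hvw⟩
  have hgrid : ∀ x ∈ evenGrid T N, x ∈ ratMidpoints (insert (ratPt β) (evenGrid T N)) ∪
      ratPt '' (T : Set (Fin n →₀ ℕ)) := by
    intro x hx
    by_cases hxT : ∃ α ∈ T, ratPt α = x
    · obtain ⟨α, hα, rfl⟩ := hxT
      exact .inr (Set.mem_image_of_mem _ hα)
    · exact .inl (hmid x (mem_ratMidpoints_of_mem_evenGrid hTe hN0 (by omega) hx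
        fun α hα h => hxT ⟨α, hα, h.symm⟩))
  have hcoe : ((insert (ratPt β) hfin.toFinset : Finset (Fin n → ℚ)) : Set (Fin n → ℚ)) =
      insert (ratPt β) (evenGrid T N) := by simp
  refine ⟨insert (ratPt β) hfin.toFinset, ⟨?_, ?_⟩, by simp, fun u hu i => ?_,
    fun u hu huβ i => ?_⟩
  · rintro _ ⟨α, hα, rfl⟩
    rw [hcoe]
    exact hmono (ratPt_mem_evenGrid hα (hTe α hα) N)
  · rw [hcoe]
    rintro x (rfl | hx)
    · obtain ⟨v, hv, w, hw, hvw⟩ := exists_evenGrid_midpoint hTe hwt hwt1 hwtb hα₀ hN0 hNwt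
      -- If the two points coincide, `β` is itself a grid point, and the argument for grid points
      -- applies.
      by_cases hne : v = w
      · refine hgrid _ ?_
        have : ratPt β = v := by
          rw [hvw, ← hne, ← two_smul ℚ v, smul_smul]; norm_num
        rwa [this]
      · exact .inl (hmid _ ⟨v, hv, w, hw, hne, hvw⟩)
    · exact hgrid x hx
  · rcases Finset.mem_insert.1 hu with rfl | hu
    · simp [ratPt]
    · exact (isEvenRatPt_of_mem_evenGrid hNodd (hfin.mem_toFinset.1 hu) i).1
  · exact (isEvenRatPt_of_mem_evenGrid hNodd
      (hfin.mem_toFinset.1 ((Finset.mem_insert.1 hu).resolve_left huβ)) i).2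

end SONC

theorem mainTheorem2 {n : ℕ} (f : MvPolynomial (Fin n) ℝ) :
    (∀ β ∈ SONC.negPart f, ∀ T ∈ SONC.circuits f β,
      ∃ M : Finset (Fin n → ℚ), SONC.IsOddMediatedSet T β M) ∧
    ∀ (M : (Fin n →₀ ℕ) → Finset (Fin n →₀ ℕ) → Finset (Fin n → ℚ))
      (v w : (Fin n →₀ ℕ) → Finset (Fin n →₀ ℕ) → (Fin n → ℚ) → (Fin n → ℚ)),
      (∀ β ∈ SONC.negPart f, ∀ T ∈ SONC.circuits f β, SONC.IsOddMediatedSet T β (M β T)) →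
      (∀ β ∈ SONC.negPart f, ∀ T ∈ SONC.circuits f β, ∀ u ∈ M β T \ T.image SONC.ratPt,
        v β T u ∈ M β T ∧ w β T u ∈ M β T ∧ v β T u ≠ w β T u ∧
          u = (1 / 2 : ℚ) • (v β T u + w β T u)) →
      (SONC.IsSONC f ↔
        ∃ a b : (Fin n →₀ ℕ) → Finset (Fin n →₀ ℕ) → (Fin n → ℚ) → Fin 2 → ℝ,
          SONC.toRatPoly f =
            (∑ β ∈ SONC.negPart f, ∑ T ∈ SONC.circuits f β,
              ∑ u ∈ M β T \ T.image SONC.ratPt, ∑ j : Fin 2,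
                (SONC.term ((1 / 2 : ℚ) • v β T u) (a β T u j)
                  - SONC.term ((1 / 2 : ℚ) • w β T u) (b β T u j)) ^ 2)
            + ∑ α ∈ SONC.leftover f, SONC.term (SONC.ratPt α) (f.coeff α)) := by
  refine ⟨fun β _ T hT => ?_, fun M v w hM hvw => ⟨fun hf => ?_, ?_⟩⟩
  · exact SONC.exists_isOddMediatedSet (SONC.mem_circuits.1 hT).2
  · exact (SONC.HasCircuitDecomposition.of_isSAGE hf.isSAGE_signed).exists_binomial_squares hM hvw
  · rintro ⟨a, b, hab⟩
    refine (SONC.HasCircuitDecomposition.of_isSAGE ?_).isSONC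
    -- The right-hand side is SAGE after normalization, term by term; a circuit decomposition of `f`
    -- follows, and with it (i).
    rw [hab]
    simp only [AddMonoidAlgebra.coeff_add, AddMonoidAlgebra.coeff_sum]
    refine SONC.IsSAGE.signed_add (.signed_sum _ fun β hβ => .signed_sum _ fun T hT =>
      .signed_sum _ fun u hu => .signed_sum _ fun j _ => ?_) (.signed_sum _ fun α hα => ?_)
    · obtain ⟨hv, hw, hne, huvw⟩ := hvw β hβ T hT u hu
      have huM := (Finset.mem_sdiff.1 hu).1
      refine SONC.isSAGE_signed_binomial_sq ((hM β hβ T hT).isEvenRatPt huM hv hw hne huvw)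
        ((hM β hβ T hT).isEvenRatPt huM hw hv hne.symm (by rw [add_comm]; exact huvw)) huvw _ _
    · obtain ⟨h1, h2⟩ := SONC.mem_posPart.1 (SONC.mem_leftover.1 hα).1
      exact SONC.isSAGE_signed_term (SONC.isEvenRatPt_ratPt.2 h1) h2.le
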